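/- Conventions. For a finitely generated $\mathbb{C}$-algebra $R$ let $X(\mathbb{C})$ be the set of $\mathbb{C}$-points of $X=\operatorname{Spec} R$ with the complex topology. For an ideal $I=(f_1,\ldots,f_n)\subseteq R$, the *continuous closure* $I^{\mathrm{cont}}$ is the set of all $f\in R$ such that $f=q_1f_1+\cdots+q_nf_n$ on $X(\mathbb{C})$ for some continuous functions $q_1,\ldots,q_n: X(\mathbb{C})\to\mathbb{C}$. A *ring of axes* over $\mathbb{C}$ is a one-dimensional reduced $\mathbb{C}$-algebra $T$ of finite type such that the integral components of $\operatorname{Spec} T$ are normal and meet transversally (that is, with linearly independent tangent lines) in one closed point $P$, no two of them having another common point, and such that the embedding dimension at $P$ equals the number of components. The *axes closure* $I^{\mathrm{ax}}$ of an ideal $I$ of a commutative ring $R$ is the set of all $f\in R$ such that $\varphi(f)\in\varphi(I)T$ for every ring homomorphism $\varphi:R\to T$ to a ring of axes $T$ over $\mathbb{C}$. Theorem 5.1. Let $m\in\mathbb{N}$ and let $I\subset\mathbb{C}[z_1,\ldots,z_m]$ be a primary ideal which is generated by monomials. Let $\Gamma=\{\gamma\in\mathbb{N}^m: z^\gamma\in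 I\}$ be its exponent set, and let $\overline{\Gamma}$ be the convex hull of $\Gamma$ in $\mathbb{R}_+^m=\{x\in\mathbb{R}^m: x_i\ge 0 \text{ for all } i\}$. Then $$I^{\mathrm{cont}}=I^{\mathrm{ax}},$$ and both are equal to the monomial ideal generated by the monomials $z^\gamma\in I$ together with the monomials $z^\gamma$, $\gamma\in\mathbb{N}^m$, whose exponent $\gamma$ lies in the interior of $\overline{\Gamma}$, the interior being taken in the topological space $\mathbb{R}_+^m$ (with the subspace topology of $\mathbb{R}^m$). -/

import Mathlib

open Topology

universe u v

/-! ### The continuous closure of an ideal -/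

/-- The set `X(ℂ)` of complex points of `X = Spec R`, for a `ℂ`-algebra `R`: a point is a
`ℂ`-algebra homomorphism `x : R → ℂ`, and the value of `f ∈ R` at `x` is `x f`. -/
def ComplexPoints (R : Type u) [CommRing R] [Algebra ℂ R] : Type u := R →ₐ[ℂ] ℂ

/-- The complex topology on `X(ℂ)`: the coarsest topology making every `f ∈ R` continuous.
If `R` is generated by `r₁, …, rₙ`, it is the topology that `X(ℂ)` inherits from the closed
embedding `x ↦ (x r₁, …, x rₙ)` into `ℂⁿ`. -/
noncomputable instance ComplexPoints.instTopologicalSpace (R : Type u) [CommRing R] [Algebra ℂ R] :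
    TopologicalSpace (ComplexPoints R) :=
  TopologicalSpace.induced
    (fun (x : ComplexPoints R) (f : R) => (show R →ₐ[ℂ] ℂ from x) f) inferInstance

/-- The value `f(x)` of `f ∈ R` at a complex point `x`. -/
def ComplexPoints.eval {R : Type u} [CommRing R] [Algebra ℂ R] (f : R) (x : ComplexPoints R) : ℂ :=
  (show R →ₐ[ℂ] ℂ from x) f

theorem ComplexPoints.continuous_eval {R : Type u} [CommRing R] [Algebra ℂ R] (f : R) :
    Continuous (ComplexPoints.eval f) :=
  (continuous_apply f).comp continuous_induced_dom

/-- The ring homomorphism `R → C(X(ℂ), ℂ)` sending `f` to the continuous function it defines. -/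
noncomputable def toContinuousFunctions (R : Type u) [CommRing R] [Algebra ℂ R] :
    R →+* C(ComplexPoints R, ℂ) where
  toFun f := ⟨ComplexPoints.eval f, ComplexPoints.continuous_eval f⟩
  map_one' := by ext x; exact map_one (show R →ₐ[ℂ] ℂ from x)
  map_zero' := by ext x; exact map_zero (show R →ₐ[ℂ] ℂ from x)
  map_mul' f g := by ext x; exact map_mul (show R →ₐ[ℂ] ℂ from x) f g
  map_add' f g := by ext x; exact map_add (show R →ₐ[ℂ] ℂ from x) f g

/-- The continuous closure `I^cont`: the contraction to `R` of the extension of `I` to the ring of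
continuous complex-valued functions on `X(ℂ)`. See `mem_continuousClosure_span_iff` for the
description by means of ideal generators. -/
noncomputable def continuousClosure {R : Type u} [CommRing R] [Algebra ℂ R] (I : Ideal R) : Ideal R :=
  (I.map (toContinuousFunctions R)).comap (toContinuousFunctions R)

/-- `f ∈ (f₁, …, fₙ)^cont` iff `f = q₁ f₁ + ⋯ + qₙ fₙ` on `X(ℂ)` for some continuous functions
`q₁, …, qₙ : X(ℂ) → ℂ`. -/
theorem mem_continuousClosure_span_iff {R : Type u} [CommRing R] [Algebra ℂ R] {n : ℕ}
    (g : Fin n → R) (f : R) :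
    f ∈ continuousClosure (Ideal.span (Set.range g)) ↔
      ∃ q : Fin n → ComplexPoints R → ℂ, (∀ i, Continuous (q i)) ∧
        ∀ x, ComplexPoints.eval f x = ∑ i, q i x * ComplexPoints.eval (g i) x := by
  rw [continuousClosure, Ideal.mem_comap, Ideal.map_span, ← Set.range_comp,
    Ideal.mem_span_range_iff_exists_fun]
  constructor
  · rintro ⟨c, hc⟩
    refine ⟨fun i => c i, fun i => (c i).continuous, fun x => ?_⟩
    have h := DFunLike.congr_fun hc x
    rw [ContinuousMap.sum_apply] at h
    exact h.symm
  · rintro ⟨q, hq, h⟩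
    refine ⟨fun i => ⟨q i, hq i⟩, ?_⟩
    ext x
    rw [ContinuousMap.sum_apply]
    exact (h x).symm

/-! ### Rings of axes and the axes closure of an ideal -/

/-- The embedding dimension of `Spec T` at the closed point given by a maximal ideal `P`: the
dimension of the cotangent space `P / P²` over the residue field `T / P`. -/
noncomputable def embeddingDimensionAt {T : Type u} [CommRing T] (P : Ideal T) : ℕ :=
  Module.finrank (T ⧸ P) P.Cotangent

/-- `P` is the origin of a system of axes in `Spec T`: the integral components of `Spec T` (given by
the minimal primes of `T`) meet transversally in the closed point `P`, and the embedding dimension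
at `P` is the number of components. -/
structure IsOriginOfAxes {T : Type u} [CommRing T] (P : Ideal T) : Prop where
  isMaximal : P.IsMaximal
  /-- Every component passes through `P`. -/
  le_origin : ∀ p ∈ minimalPrimes T, p ≤ P
  /-- Two different components have no point other than `P` in common. -/
  meet_only : ∀ p ∈ minimalPrimes T, ∀ q ∈ minimalPrimes T, p ≠ q →
    ∀ Q : Ideal T, Q.IsPrime → p ≤ Q → q ≤ Q → Q = P
  /-- The tangent lines of the components at `P` are linearly independent in the Zariski tangent
  space of `Spec T` at `P`. Stated dually: the cotangent space `P / P²` of `Spec T` at `P` maps onto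
  the product, over all components `V(p)`, of the cotangent spaces `P / (p + P²)` of `V(p)`
  at `P`. -/
  transversal : ∀ a : Ideal T → T, (∀ p ∈ minimalPrimes T, a p ∈ P) →
    ∃ x ∈ P, ∀ p ∈ minimalPrimes T, x - a p ∈ p ⊔ P ^ 2
  embeddingDimension_eq : embeddingDimensionAt P = (minimalPrimes T).ncard

/-- `T` is a ring of axes over `K`, that is, `Spec T` is a scheme of axes over `K`: a
one-dimensional reduced affine scheme of finite type over `K` whose integral components are normal,
meet transversally in one point, the embedding dimension at this point being the number of
components. -/
structure IsRingOfAxes (K : Type u) [Field K] (T : Type u) [CommRing T] [Algebra K T] : Prop where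
  finiteType : Algebra.FiniteType K T
  isReduced : IsReduced T
  dimension_one : ringKrullDim T = 1
  normal : ∀ p ∈ minimalPrimes T, IsIntegrallyClosed (T ⧸ p)
  exists_origin : ∃ P : Ideal T, IsOriginOfAxes P

/-- The `K`-axes closure `I^ax`: all `f` with `φ f ∈ φ(I) T` for every ring homomorphism `φ : R → T`
to a ring of axes `T` over `K`. (Up to isomorphism, all `K`-algebras of finite type live in the
universe of `K`.) -/
def axesClosure (K : Type u) [Field K] {R : Type v} [CommRing R] (I : Ideal R) : Ideal R where
  carrier := {f | ∀ (T : Type u) [CommRing T] [Algebra K T], IsRingOfAxes K T →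
    ∀ φ : R →+* T, φ f ∈ I.map φ}
  zero_mem' := by
    intro T _ _ _ φ
    rw [map_zero]
    exact zero_mem _
  add_mem' := by
    intro f g hf hg T _ _ hT φ
    rw [map_add]
    exact add_mem (hf T hT φ) (hg T hT φ)
  smul_mem' := by
    intro r f hf T _ _ hT φ
    rw [smul_eq_mul, map_mul]
    exact Ideal.mul_mem_left _ _ (hf T hT φ)

/-! ### Monomial ideals -/

/-- An ideal of `K[z₁, …, zₘ]` is monomial if it is generated by monomials `z^γ`. -/
def IsMonomialIdeal {K : Type u} [Field K] {m : ℕ} (I : Ideal (MvPolynomial (Fin m) K)) : Prop :=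
  ∃ S : Set (Fin m →₀ ℕ), I = Ideal.span ((fun γ => MvPolynomial.monomial γ (1 : K)) '' S)

/-- The exponent set `Γ = {γ ∈ ℕ^m : z^γ ∈ I}`. -/
def exponentSet {K : Type u} [Field K] {m : ℕ} (I : Ideal (MvPolynomial (Fin m) K)) :
    Set (Fin m →₀ ℕ) :=
  {γ | MvPolynomial.monomial γ (1 : K) ∈ I}

/-- An exponent, seen as a point of `ℝ^m`. -/
def realExponent {m : ℕ} (γ : Fin m →₀ ℕ) : Fin m → ℝ := fun i => (γ i : ℝ)

/-- The orthant `ℝ₊^m` of vectors with nonnegative coordinates. -/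
def orthant (m : ℕ) : Set (Fin m → ℝ) := {x | ∀ i, 0 ≤ x i}

/-- The interior of the convex hull of `Γ` in `ℝ₊^m`, where `ℝ₊^m` carries the subspace topology of
`ℝ^m`: the points of `ℝ₊^m` of which the convex hull of `Γ` is a neighbourhood within `ℝ₊^m`. -/
def interiorConvexHull {m : ℕ} (Γ : Set (Fin m →₀ ℕ)) : Set (Fin m → ℝ) :=
  {x | x ∈ orthant m ∧ convexHull ℝ (realExponent '' Γ) ∈ 𝓝[orthant m] x}

/-! Both closures reduce to one dichotomy. Let `G` be a finite set of exponents generating `I`. By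
Farkas' lemma over `ℚ`, with denominators cleared, `γ` either has a shrinking certificate (`Σ n δ •
δ ≤ N • γ` with `Σ n δ > N`) or admits a weight `a ≥ 0` with `a·γ ≤ d ≤ a·δ` on `G` and `d > 0`
(`hasShrinkingCertificate_or_exists_weight`). The certificate characterizes the relative interior of
the hull: it places a point of the hull below a proper shrinking of `γ`, while a weight of the
second kind cannot exist for an interior `γ`.

A certificate gives `(z^γ)^N ∈ I^(N+1)`, and this algebraic condition puts any `f` in both closures.
On complex points it makes `f` small enough compared with the generators that the quotients `f *
conj gᵢ / Σ |gⱼ|²` extend continuously by zero (`mem_continuousClosure_of_pow_mem`). In a ring of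
axes it is checked at each localization: modulo a component, `f` is an element of the ideal times
some `b` in the maximal ideal, and transversality with Nakayama lifts `b` to an element vanishing on
the other components (`IsRingOfAxes.mem_of_pow_mem`).

If `γ ∉ Γ` has a weight, test along the curves `zᵢ = cᵢ^k t^aᵢ` for several `k`, with `cᵢ = 1` where
`aᵢ = 0`, so that all of them meet at `t = 0`. Comparing coefficients of `t^(a·γ)` would express
`(c^γ)^k` through the `(c^δ)^k`, `δ ∈ G`, with multipliers independent of `k`. A polynomial
vanishing at every `c^δ` but not at `c^γ` contradicts this; it exists because `I` is primary
(`exists_separating_polynomial`). The argument serves continuous functions and, with the curves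
replaced by coordinate axes, the axes closure.

Both closures are stable under rescaling the variables, hence monomial, so deciding monomials
suffices. -/

/-! ### Linear alternatives and integer certificates -/

/-- **Farkas' lemma** over an ordered field, for finitely many linear forms on a vector space. -/
theorem farkas_alternative {K V ι : Type*} [Field K] [LinearOrder K] [IsStrictOrderedRing K]
    [AddCommGroup V] [Module K V] (s : Finset ι) (f : ι → Module.Dual K V) (g : Module.Dual K V) :
    (∃ c : ι → K, (∀ i ∈ s, 0 ≤ c i) ∧ g = ∑ i ∈ s, c i • f i) ∨
      ∃ x : V, (∀ i ∈ s, 0 ≤ f i x) ∧ g x < 0 := by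
  classical
  induction s using Finset.induction_on generalizing f g with
  | empty =>
    by_cases hg : g = 0
    · exact Or.inl ⟨0, by simp, by simp [hg]⟩
    · right
      obtain ⟨x, hx⟩ : ∃ x, g x ≠ 0 := by
        by_contra! h
        exact hg (LinearMap.ext h)
      rcases lt_or_gt_of_ne hx with h | h
      · exact ⟨x, by simp, h⟩
      · exact ⟨-x, by simp, by simpa using h⟩
  | insert k s hk ih =>
    rcases ih f g with ⟨c, hc, hg⟩ | ⟨x₀, hx₀, hgx₀⟩
    · left
      refine ⟨fun i => if i = k then 0 else c i, ?_, ?_⟩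
      · intro i hi
        dsimp only
        split_ifs with h
        · exact le_rfl
        · exact hc i ((Finset.mem_insert.1 hi).resolve_left h)
      · rw [Finset.sum_insert hk, hg]
        simp only [if_true, zero_smul, zero_add]
        refine Finset.sum_congr rfl fun i hi => ?_
        rw [if_neg (ne_of_mem_of_not_mem hi hk)]
    by_cases hkx : 0 ≤ f k x₀
    · right
      refine ⟨x₀, fun i hi => ?_, hgx₀⟩
      rcases Finset.mem_insert.1 hi with rfl | hi
      · exact hkx
      · exact hx₀ i hi
    push Not at hkx
    obtain ⟨x, hx, hgx, hkx⟩ : ∃ x, (∀ i ∈ s, 0 ≤ f i x) ∧ g x < 0 ∧ f k x = -1 := by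
      have hpos : 0 < -(f k x₀)⁻¹ := by simpa using hkx
      refine ⟨(-(f k x₀)⁻¹) • x₀, fun i hi => ?_, ?_, ?_⟩
      · rw [map_smul, smul_eq_mul]
        exact mul_nonneg hpos.le (hx₀ i hi)
      · rw [map_smul, smul_eq_mul]
        exact mul_neg_of_pos_of_neg hpos hgx₀
      · rw [map_smul, smul_eq_mul, neg_mul, inv_mul_cancel₀ hkx.ne]
    -- Since `f k x = -1`, these forms are the old ones composed with the projection `y ↦ y + f k y
    -- • x` onto the kernel of `f k`; the new form `f k` thus drops out of the problem.
    rcases ih (fun i => f i + f i x • f k) (g + g x • f k) with ⟨c, hc, hg⟩ | ⟨y, hy, hgy⟩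
    · left
      refine ⟨fun i => if i = k then ∑ j ∈ s, c j * f j x - g x else c i, ?_, ?_⟩
      · intro i hi
        dsimp only
        split_ifs with h
        · have := Finset.sum_nonneg fun j hj => mul_nonneg (hc j hj) (hx j hj)
          linarith
        · exact hc i ((Finset.mem_insert.1 hi).resolve_left h)
      · rw [Finset.sum_insert hk]
        have : ∑ i ∈ s, (if i = k then ∑ j ∈ s, c j * f j x - g x else c i) • f i =
            ∑ i ∈ s, c i • f i :=
          Finset.sum_congr rfl fun i hi => by rw [if_neg (ne_of_mem_of_not_mem hi hk)]
        rw [this]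
        dsimp only
        rw [if_pos rfl]
        refine (eq_sub_of_add_eq hg).trans ?_
        ext y
        simp only [LinearMap.sub_apply, LinearMap.add_apply, LinearMap.sum_apply,
          LinearMap.smul_apply, smul_eq_mul, mul_add, Finset.sum_add_distrib, sub_mul,
          Finset.sum_mul, mul_assoc]
        ring
    · right
      refine ⟨y + f k y • x, fun i hi => ?_, ?_⟩
      · rcases Finset.mem_insert.1 hi with rfl | hi
        · simp [hkx]
        · have := hy i hi
          simp only [LinearMap.add_apply, LinearMap.smul_apply, smul_eq_mul] at this
          simp only [map_add, map_smul, smul_eq_mul]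
          linarith [mul_comm (f i x) (f k y)]
      · simp only [LinearMap.add_apply, LinearMap.smul_apply, smul_eq_mul] at hgy
        simp only [map_add, map_smul, smul_eq_mul]
        linarith [mul_comm (g x) (f k y)]

theorem exists_nat_common_multiple {ι : Type*} (s : Finset ι) (q : ι → ℚ) (hq : ∀ i ∈ s, 0 ≤ q i) :
    ∃ D : ℕ, 0 < D ∧ ∃ n : ι → ℕ, ∀ i ∈ s, (n i : ℚ) = D * q i := by
  classical
  refine ⟨∏ i ∈ s, (q i).den, Finset.prod_pos fun i _ => (q i).den_pos,
    fun i => (∏ j ∈ s.erase i, (q j).den) * (q i).num.toNat, fun i hi => ?_⟩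
  rw [← Finset.mul_prod_erase s _ hi]
  push_cast
  have h1 : (((q i).num.toNat : ℕ) : ℚ) = (q i).num := by
    exact_mod_cast congrArg (Int.cast : ℤ → ℚ) (Int.toNat_of_nonneg (Rat.num_nonneg.2 (hq i hi)))
  rw [h1, ← Rat.den_mul_eq_num (q i)]
  ring

/-- A natural-number certificate that `γ` dominates a convex combination, shrunk by a factor
less than `1`, of the exponents in `G`. -/
def HasShrinkingCertificate {m : ℕ} (G : Finset (Fin m →₀ ℕ)) (γ : Fin m →₀ ℕ) : Prop :=
  ∃ (n : (Fin m →₀ ℕ) → ℕ) (N : ℕ), N < ∑ δ ∈ G, n δ ∧ ∑ δ ∈ G, n δ • δ ≤ N • γ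

/-- The value of the linear form with coefficients `a` at an exponent. -/
def weightedDegree {m : ℕ} (a : Fin m → ℕ) (γ : Fin m →₀ ℕ) : ℕ := ∑ i, a i * γ i

/-- Farkas is applied to pairs `(x, d)` with the forms `xᵢ`, `δ·x - d`, `d - γ·x` and target `-d`. A
separating pair is the weight; a nonnegative combination, with denominators cleared, is the
certificate. -/
theorem hasShrinkingCertificate_or_exists_weight {m : ℕ} (G : Finset (Fin m →₀ ℕ))
    (γ : Fin m →₀ ℕ) :
    HasShrinkingCertificate G γ ∨ ∃ (a : Fin m → ℕ) (d : ℕ), 0 < d ∧ weightedDegree a γ ≤ d ∧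
      ∀ δ ∈ G, d ≤ weightedDegree a δ := by
  classical
  let pair : (Fin m →₀ ℕ) → Module.Dual ℚ ((Fin m → ℚ) × ℚ) := fun δ =>
    ∑ i, (δ i : ℚ) • (LinearMap.proj i ∘ₗ LinearMap.fst ℚ (Fin m → ℚ) ℚ)
  have hpair : ∀ δ (x : (Fin m → ℚ) × ℚ), pair δ x = ∑ i, (δ i : ℚ) * x.1 i := fun δ x => by
    simp [pair, LinearMap.sum_apply]
  let f : Fin m ⊕ (Fin m →₀ ℕ) ⊕ Unit → Module.Dual ℚ ((Fin m → ℚ) × ℚ) := Sum.elim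
    (fun i => LinearMap.proj i ∘ₗ LinearMap.fst ℚ (Fin m → ℚ) ℚ)
    (Sum.elim (fun δ => pair δ - LinearMap.snd ℚ _ _) fun _ => LinearMap.snd ℚ _ _ - pair γ)
  rcases farkas_alternative (Finset.univ.disjSum (G.disjSum Finset.univ)) f
    (-LinearMap.snd ℚ _ _) with ⟨c, hc, hg⟩ | ⟨x, hx, hgx⟩
  · left
    have key : ∀ x : (Fin m → ℚ) × ℚ, -x.2 = ∑ i, c (.inl i) * x.1 i +
        (∑ δ ∈ G, c (.inr (.inl δ)) * (∑ i, (δ i : ℚ) * x.1 i - x.2) +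
          c (.inr (.inr ())) * (x.2 - ∑ i, (γ i : ℚ) * x.1 i)) := by
      intro x
      have := LinearMap.congr_fun hg x
      simpa [f, hpair, LinearMap.sum_apply, Finset.sum_disjSum] using this
    have h0 : ∀ i, 0 ≤ c (.inl i) := fun i => hc _ (by simp)
    have h1 : ∀ δ ∈ G, 0 ≤ c (.inr (.inl δ)) := fun δ hδ => hc _ (by simpa using hδ)
    have h2 : 0 ≤ c (.inr (.inr ())) := hc _ (by simp)
    set v := c (.inr (.inr ())) with hv
    -- Evaluation at `(0, 1)`; the surplus `1` over `v` becomes the strict inequality of the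
    -- certificate.
    have hsum : ∑ δ ∈ G, c (.inr (.inl δ)) = 1 + v := by
      have := key (0, 1)
      simp at this
      linarith
    have hle : ∀ i, ∑ δ ∈ G, c (.inr (.inl δ)) * δ i ≤ v * γ i := by
      intro i
      have := key (Pi.single i 1, 0)
      simp [Pi.single_apply] at this
      linarith [h0 i]
    obtain ⟨D, hD, n, hn⟩ := exists_nat_common_multiple (G.disjSum Finset.univ)
      (fun j => c (.inr j)) (fun j hj => hc _ (by simpa using hj))
    have hn1 : ∀ δ ∈ G, (n (.inl δ) : ℚ) = D * c (.inr (.inl δ)) := fun δ hδ =>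
      hn (.inl δ) (by simpa using hδ)
    have hn2 : (n (.inr ()) : ℚ) = D * v := hn (.inr ()) (by simp)
    have hD' : (0 : ℚ) < D := by exact_mod_cast hD
    refine ⟨fun δ => n (.inl δ), n (.inr ()), ?_, fun i => ?_⟩
    · have : (n (.inr ()) : ℚ) < ∑ δ ∈ G, (n (.inl δ) : ℚ) := by
        rw [Finset.sum_congr rfl hn1, ← Finset.mul_sum, hsum, hn2]
        nlinarith
      exact_mod_cast this
    · have : ∑ δ ∈ G, (n (.inl δ) : ℚ) * δ i ≤ n (.inr ()) * γ i := by
        rw [Finset.sum_congr rfl fun δ hδ => by rw [hn1 δ hδ, mul_assoc], ← Finset.mul_sum, hn2,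
          mul_assoc]
        exact mul_le_mul_of_nonneg_left (hle i) hD'.le
      rw [Finsupp.finsetSum_apply]
      simp only [Finsupp.smul_apply, smul_eq_mul]
      exact_mod_cast this
  · right
    have h0 : ∀ i, 0 ≤ x.1 i := fun i => by
      simpa [f] using hx (.inl i) (by simp)
    have h1 : ∀ δ ∈ G, x.2 ≤ ∑ i, (δ i : ℚ) * x.1 i := fun δ hδ => by
      simpa [f, hpair] using hx (.inr (.inl δ)) (by simpa using hδ)
    have h2 : ∑ i, (γ i : ℚ) * x.1 i ≤ x.2 := by
      simpa [f, hpair] using hx (.inr (.inr ())) (by simp)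
    have h3 : 0 < x.2 := by simpa using hgx
    obtain ⟨D, hD, n, hn⟩ := exists_nat_common_multiple Finset.univ
      (fun j : Option (Fin m) => j.elim x.2 x.1) (by
        rintro (_ | i) -
        · exact h3.le
        · exact h0 i)
    have hn1 : ∀ i, (n (some i) : ℚ) = D * x.1 i := fun i => hn (some i) (by simp)
    have hn2 : (n none : ℚ) = D * x.2 := hn none (by simp)
    have hD' : (0 : ℚ) < D := by exact_mod_cast hD
    have hw : ∀ δ, (weightedDegree (fun i => n (some i)) δ : ℚ) =
        D * ∑ i, (δ i : ℚ) * x.1 i := fun δ => by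
      rw [weightedDegree]
      push_cast
      rw [Finset.mul_sum]
      refine Finset.sum_congr rfl fun i _ => ?_
      rw [hn1]
      ring
    refine ⟨fun i => n (some i), n none, ?_, ?_, fun δ hδ => ?_⟩
    · have : (0 : ℚ) < n none := by rw [hn2]; positivity
      exact_mod_cast this
    · have : (weightedDegree (fun i => n (some i)) γ : ℚ) ≤ n none := by
        rw [hw, hn2]
        exact mul_le_mul_of_nonneg_left h2 hD'.le
      exact_mod_cast this
    · have : (n none : ℚ) ≤ weightedDegree (fun i => n (some i)) δ := by
        rw [hw, hn2]
        exact mul_le_mul_of_nonneg_left (h1 δ hδ) hD'.le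
      exact_mod_cast this

/-! ### Convex hulls and the relative interior -/

theorem weightedDegree_mono {m : ℕ} (a : Fin m → ℕ) : Monotone (weightedDegree a) :=
  fun _ _ h => Finset.sum_le_sum fun i _ => Nat.mul_le_mul_left _ (h i)

/-- The convex hull of an upward closed set of exponents is upward closed. -/
theorem convexHull_realExponent_upward {m : ℕ} {Γ : Set (Fin m →₀ ℕ)} (hΓ : IsUpperSet Γ)
    {x y : Fin m → ℝ} (hx : x ∈ convexHull ℝ (realExponent '' Γ)) (hxy : x ≤ y) :
    y ∈ convexHull ℝ (realExponent '' Γ) := by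
  classical
  have hnat : ∀ (δ : Fin m →₀ ℕ) (x : Fin m → ℝ), x ∈ convexHull ℝ (realExponent '' Γ) →
      x + realExponent δ ∈ convexHull ℝ (realExponent '' Γ) := by
    intro δ x hx
    have h1 : Convex ℝ ((fun x => x + realExponent δ) ⁻¹' convexHull ℝ (realExponent '' Γ)) :=
      (convex_convexHull ℝ _).translate_preimage_left _
    refine convexHull_min ?_ h1 hx
    rintro _ ⟨γ, hγ, rfl⟩
    refine subset_convexHull _ _ ⟨γ + δ, hΓ le_self_add hγ, ?_⟩
    ext i
    simp [realExponent]
  -- A real translation along an axis is a convex combination of no translation and an integer one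
  -- of length `n > t`.
  have hstep : ∀ (i : Fin m) (t : ℝ), 0 ≤ t → ∀ x ∈ convexHull ℝ (realExponent '' Γ),
      x + Pi.single i t ∈ convexHull ℝ (realExponent '' Γ) := by
    intro i t ht x hx
    obtain ⟨n, hn⟩ := exists_nat_gt t
    have hn0 : (0 : ℝ) < n := ht.trans_lt hn
    have h1 := hnat (Finsupp.single i n) x hx
    have h2 := (convex_convexHull ℝ (realExponent '' Γ)) hx h1
      (a := 1 - t / n) (b := t / n) (by rw [sub_nonneg, div_le_one hn0]; exact hn.le)
      (by positivity) (by ring)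
    convert h2 using 1
    ext j
    by_cases hj : j = i
    · subst hj
      simp [realExponent]
      field_simp
      ring
    · simp [realExponent, hj]
      ring
  have hall : ∀ s : Finset (Fin m), x + ∑ i ∈ s, Pi.single i (y i - x i) ∈
      convexHull ℝ (realExponent '' Γ) := by
    intro s
    induction s using Finset.induction_on with
    | empty => simpa using hx
    | insert i s hi ih =>
      rw [Finset.sum_insert hi, add_comm (Pi.single i _ : Fin m → ℝ), ← add_assoc]
      exact hstep i _ (sub_nonneg.2 (hxy i)) _ ih
  have := hall Finset.univ
  rwa [Finset.univ_sum_single, show (x + fun i => y i - x i) = y by ext i; simp] at this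

/-- The normalized combination lies in the hull and below `(N/S) γ`, with `N/S < 1`. Nearby points
of the orthant still dominate it: there is slack where `γ i > 0`, and where `γ i = 0` the bound is
just nonnegativity. This is where the relative topology matters. -/
theorem HasShrinkingCertificate.mem_interiorConvexHull {m : ℕ} {Γ : Set (Fin m →₀ ℕ)}
    (hΓ : IsUpperSet Γ) {G : Finset (Fin m →₀ ℕ)} (hG : (G : Set _) ⊆ Γ) {γ : Fin m →₀ ℕ}
    (h : HasShrinkingCertificate G γ) : realExponent γ ∈ interiorConvexHull Γ := by
  obtain ⟨n, N, hN, hle⟩ := h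
  set S := ∑ δ ∈ G, n δ with hS
  have hS0 : (0 : ℝ) < S := by exact_mod_cast (Nat.zero_le N).trans_lt hN
  have hN' : (N : ℝ) < S := by exact_mod_cast hN
  refine ⟨fun i => Nat.cast_nonneg _, ?_⟩
  have hc : ∑ δ ∈ G, ((n δ : ℝ) / S) • realExponent δ ∈ convexHull ℝ (realExponent '' Γ) := by
    refine (convex_convexHull ℝ _).sum_mem (fun δ _ => by positivity) ?_
      fun δ hδ => subset_convexHull _ _ ⟨δ, hG hδ, rfl⟩
    rw [← Finset.sum_div, div_eq_one_iff_eq hS0.ne', hS]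
    push_cast
    rfl
  have hci : ∀ i, (∑ δ ∈ G, ((n δ : ℝ) / S) • realExponent δ) i ≤ N / S * γ i := by
    intro i
    have h1 : (∑ δ ∈ G, n δ • δ) i ≤ N * γ i := hle i
    rw [Finsupp.finsetSum_apply] at h1
    have h2 : ∑ δ ∈ G, (n δ : ℝ) * δ i ≤ N * γ i := by exact_mod_cast h1
    rw [Finset.sum_apply]
    simp only [Pi.smul_apply, smul_eq_mul, realExponent, div_mul_eq_mul_div]
    rw [← Finset.sum_div]
    gcongr
  have hev : ∀ᶠ x : Fin m → ℝ in 𝓝[orthant m] (realExponent γ), ∀ i, (N : ℝ) / S * γ i ≤ x i := by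
    rw [Filter.eventually_all]
    intro i
    rcases Nat.eq_zero_or_pos (γ i) with h0 | h0
    · filter_upwards [self_mem_nhdsWithin] with x hx
      simpa [h0] using hx i
    · have h0' : (0 : ℝ) < γ i := by exact_mod_cast h0
      have : (N : ℝ) / S * γ i < realExponent γ i := by
        simp only [realExponent]
        have : (N : ℝ) / S < 1 := (div_lt_one hS0).2 hN'
        nlinarith
      filter_upwards [nhdsWithin_le_nhds
        ((continuous_apply i).continuousAt.eventually (lt_mem_nhds this))] with x hx
      exact le_of_lt hx
  filter_upwards [hev] with x hx
  exact convexHull_realExponent_upward hΓ hc fun i => (hci i).trans (hx i)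

/-- Some `(1 - t) γ` with `0 < t < 1` remains in the hull, hence in the half-space `d ≤ a·x`;
positivity of `d` makes the resulting inequality for `γ` strict. -/
theorem lt_weightedDegree_of_mem_interiorConvexHull {m : ℕ} {Γ : Set (Fin m →₀ ℕ)}
    {γ : Fin m →₀ ℕ} (h : realExponent γ ∈ interiorConvexHull Γ) {a : Fin m → ℕ} {d : ℕ}
    (hd : 0 < d) (ha : ∀ δ ∈ Γ, d ≤ weightedDegree a δ) : d < weightedDegree a γ := by
  obtain ⟨h0, hn⟩ := h
  have hcont : Filter.Tendsto (fun t : ℝ => (1 - t) • realExponent γ) (𝓝[>] 0)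
      (𝓝[orthant m] (realExponent γ)) := by
    refine tendsto_nhdsWithin_iff.2 ⟨?_, ?_⟩
    · have : Filter.Tendsto (fun t : ℝ => (1 - t) • realExponent γ) (𝓝 0)
          (𝓝 ((1 - (0 : ℝ)) • realExponent γ)) :=
        Continuous.tendsto (by fun_prop) 0
      simp only [sub_zero, one_smul] at this
      exact this.mono_left nhdsWithin_le_nhds
    · filter_upwards [Ioo_mem_nhdsGT (zero_lt_one' ℝ)] with t ht i
      exact mul_nonneg (by linarith [ht.2]) (h0 i)
  have hev : ∀ᶠ t : ℝ in 𝓝[>] 0, (1 - t) • realExponent γ ∈ convexHull ℝ (realExponent '' Γ) :=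
    hcont hn
  obtain ⟨t, hmem, ht0, ht1⟩ := (hev.and (Ioo_mem_nhdsGT (zero_lt_one' ℝ))).exists
  have hsub : convexHull ℝ (realExponent '' Γ) ⊆ {x | (d : ℝ) ≤ ∑ i, (a i : ℝ) * x i} := by
    refine convexHull_min ?_ ?_
    · rintro _ ⟨δ, hδ, rfl⟩
      have := ha δ hδ
      simp only [Set.mem_ofPred_eq, realExponent]
      exact_mod_cast this
    · refine convex_halfSpace_ge ⟨fun x y => ?_, fun c x => ?_⟩ _
      · simp [mul_add, Finset.sum_add_distrib]
      · simp only [Pi.smul_apply, smul_eq_mul, Finset.mul_sum]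
        exact Finset.sum_congr rfl fun i _ => by ring
  have h1 : (d : ℝ) ≤ (1 - t) * weightedDegree a γ := by
    refine (hsub hmem).trans_eq ?_
    rw [weightedDegree]
    push_cast
    rw [Finset.mul_sum]
    refine Finset.sum_congr rfl fun i _ => ?_
    simp only [Pi.smul_apply, realExponent, smul_eq_mul]
    ring
  have hd' : (0 : ℝ) < d := by exact_mod_cast hd
  have : (d : ℝ) < weightedDegree a γ := by nlinarith
  exact_mod_cast this

/-! ### Exponent sets of monomial ideals -/

theorem isUpperSet_exponentSet {K : Type u} [Field K] {m : ℕ}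
    (I : Ideal (MvPolynomial (Fin m) K)) : IsUpperSet (exponentSet I) := by
  intro γ δ h hγ
  have : MvPolynomial.monomial δ (1 : K) =
      MvPolynomial.monomial (δ - γ) 1 * MvPolynomial.monomial γ 1 := by
    rw [MvPolynomial.monomial_mul, tsub_add_cancel_of_le h, mul_one]
  rw [exponentSet, Set.mem_ofPred_eq, this]
  exact I.mul_mem_left _ hγ

theorem IsMonomialIdeal.exists_finset {K : Type u} [Field K] {m : ℕ}
    {I : Ideal (MvPolynomial (Fin m) K)} (hI : IsMonomialIdeal I) :
    ∃ G : Finset (Fin m →₀ ℕ), (G : Set _) ⊆ exponentSet I ∧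
      I = Ideal.span ((fun γ => MvPolynomial.monomial γ (1 : K)) '' (G : Set _)) ∧
      ∀ δ ∈ exponentSet I, ∃ γ ∈ G, γ ≤ δ := by
  classical
  obtain ⟨S, hS⟩ := hI
  have hfg : (Ideal.span ((fun γ => MvPolynomial.monomial γ (1 : K)) '' S)).FG :=
    IsNoetherian.noetherian _
  obtain ⟨F, hF, hspan⟩ := (Submodule.fg_span_iff_fg_span_finset_subset _).1 hfg
  obtain ⟨G, hGS, hGF⟩ := Finset.subset_set_image_iff.1 hF
  have hI : I = Ideal.span ((fun γ => MvPolynomial.monomial γ (1 : K)) '' (G : Set _)) := by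
    rw [hS, Ideal.span, hspan, ← hGF, Finset.coe_image]
  refine ⟨G, fun γ hγ => ?_, hI, fun δ hδ => ?_⟩
  · rw [exponentSet, Set.mem_ofPred_eq, hI]
    exact Ideal.subset_span ⟨γ, hγ, rfl⟩
  · rw [exponentSet, Set.mem_ofPred_eq, hI, MvPolynomial.mem_ideal_span_monomial_image] at hδ
    exact hδ δ (by simp [MvPolynomial.support_monomial])

theorem HasShrinkingCertificate.monomial_pow_mem {K : Type u} [Field K] {m : ℕ}
    {I : Ideal (MvPolynomial (Fin m) K)} {G : Finset (Fin m →₀ ℕ)}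
    (hG : (G : Set _) ⊆ exponentSet I) {γ : Fin m →₀ ℕ} (h : HasShrinkingCertificate G γ) :
    ∃ N : ℕ, MvPolynomial.monomial γ (1 : K) ^ N ∈ I ^ (N + 1) := by
  obtain ⟨n, N, hN, hle⟩ := h
  refine ⟨N, Ideal.pow_le_pow_right hN ?_⟩
  have h1 : ∏ δ ∈ G, MvPolynomial.monomial δ (1 : K) ^ n δ ∈ I ^ ∑ δ ∈ G, n δ := by
    rw [← Finset.prod_pow_eq_pow_sum]
    exact Ideal.prod_mem_prod fun δ hδ => Ideal.pow_mem_pow (hG hδ) _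
  have h2 : MvPolynomial.monomial γ (1 : K) ^ N =
      MvPolynomial.monomial (N • γ - ∑ δ ∈ G, n δ • δ) 1 *
        ∏ δ ∈ G, MvPolynomial.monomial δ (1 : K) ^ n δ := by
    simp only [MvPolynomial.monomial_pow, one_pow]
    rw [← MvPolynomial.monomial_sum_one, MvPolynomial.monomial_mul, tsub_add_cancel_of_le hle,
      mul_one]
  rw [h2]
  exact Ideal.mul_mem_left _ _ h1

/-! ### The continuous closure -/

theorem ComplexPoints.eval_add {R : Type u} [CommRing R] [Algebra ℂ R] (f g : R)
    (x : ComplexPoints R) : eval (f + g) x = eval f x + eval g x :=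
  map_add (show R →ₐ[ℂ] ℂ from x) f g

theorem ComplexPoints.eval_mul {R : Type u} [CommRing R] [Algebra ℂ R] (f g : R)
    (x : ComplexPoints R) : eval (f * g) x = eval f x * eval g x :=
  map_mul (show R →ₐ[ℂ] ℂ from x) f g

theorem ComplexPoints.eval_pow {R : Type u} [CommRing R] [Algebra ℂ R] (f : R) (n : ℕ)
    (x : ComplexPoints R) : eval (f ^ n) x = eval f x ^ n :=
  map_pow (show R →ₐ[ℂ] ℂ from x) f n

theorem le_continuousClosure {R : Type u} [CommRing R] [Algebra ℂ R] (I : Ideal R) :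
    I ≤ continuousClosure I := Ideal.le_comap_map

/-- Elements of `I ^ k` grow at most like the `k`-th power of the size of the generators of `I`. -/
theorem exists_continuous_norm_eval_le_of_mem_pow {R : Type u} [CommRing R] [Algebra ℂ R] {n : ℕ}
    (g : Fin n → R) (k : ℕ) (h : R) (hh : h ∈ Ideal.span (Set.range g) ^ k) :
    ∃ C : ComplexPoints R → ℝ, Continuous C ∧ (∀ x, 0 ≤ C x) ∧
      ∀ x, ‖ComplexPoints.eval h x‖ ≤ C x * (∑ i, ‖ComplexPoints.eval (g i) x‖) ^ k := by
  induction k generalizing h with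
  | zero =>
    exact ⟨fun x => ‖ComplexPoints.eval h x‖, (ComplexPoints.continuous_eval h).norm,
      fun x => norm_nonneg _, fun x => by simp⟩
  | succ k ih =>
    rw [pow_succ] at hh
    refine Submodule.mul_induction_on hh (fun a ha b hb => ?_) fun a b ha hb => ?_
    · obtain ⟨A, hAc, hA0, hA⟩ := ih a ha
      obtain ⟨c, rfl⟩ := Ideal.mem_span_range_iff_exists_fun.1 hb
      refine ⟨fun x => A x * ∑ i, ‖ComplexPoints.eval (c i) x‖,
        hAc.mul (continuous_finsetSum _ fun i _ => (ComplexPoints.continuous_eval _).norm),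
        fun x => mul_nonneg (hA0 x) (Finset.sum_nonneg fun _ _ => norm_nonneg _), fun x => ?_⟩
      have hb' : ‖ComplexPoints.eval (∑ i, c i * g i) x‖ ≤
          (∑ i, ‖ComplexPoints.eval (c i) x‖) * ∑ i, ‖ComplexPoints.eval (g i) x‖ := by
        have : ComplexPoints.eval (∑ i, c i * g i) x =
            ∑ i, ComplexPoints.eval (c i) x * ComplexPoints.eval (g i) x :=
          (map_sum (show R →ₐ[ℂ] ℂ from x) _ _).trans
            (Finset.sum_congr rfl fun i _ => ComplexPoints.eval_mul _ _ _)
        rw [this, Finset.sum_mul]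
        refine (norm_sum_le _ _).trans (Finset.sum_le_sum fun i _ => ?_)
        rw [norm_mul]
        exact mul_le_mul_of_nonneg_left
          (Finset.single_le_sum (f := fun i => ‖ComplexPoints.eval (g i) x‖)
            (fun _ _ => norm_nonneg _) (Finset.mem_univ i)) (norm_nonneg _)
      rw [ComplexPoints.eval_mul, norm_mul]
      calc _ ≤ (A x * (∑ i, ‖ComplexPoints.eval (g i) x‖) ^ k) *
            ((∑ i, ‖ComplexPoints.eval (c i) x‖) * ∑ i, ‖ComplexPoints.eval (g i) x‖) :=
            mul_le_mul (hA x) hb' (norm_nonneg _) ((norm_nonneg _).trans (hA x))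
        _ = _ := by ring
    · obtain ⟨A, hAc, hA0, hA⟩ := ha
      obtain ⟨B, hBc, hB0, hB⟩ := hb
      refine ⟨fun x => A x + B x, hAc.add hBc, fun x => add_nonneg (hA0 x) (hB0 x), fun x => ?_⟩
      rw [ComplexPoints.eval_add, add_mul]
      exact (norm_add_le _ _).trans (add_le_add (hA x) (hB x))

/-- If a power of `f` lies in a higher power of `I`, then `f` is in the continuous closure. -/
theorem mem_continuousClosure_of_pow_mem {R : Type u} [CommRing R] [Algebra ℂ R] {I : Ideal R}
    (hI : I.FG) {f : R} {N : ℕ} (hf : f ^ N ∈ I ^ (N + 1)) : f ∈ continuousClosure I := by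
  rcases Nat.eq_zero_or_pos N with rfl | hN
  · rw [pow_zero, zero_add, pow_one] at hf
    rw [(Ideal.eq_top_iff_one I).2 hf]
    exact le_continuousClosure _ trivial
  obtain ⟨n, g, rfl⟩ := Submodule.fg_iff_exists_fin_generating_family.1 hI
  obtain ⟨C, hCc, hC0, hC⟩ := exists_continuous_norm_eval_le_of_mem_pow g (N + 1) _ hf
  refine (mem_continuousClosure_span_iff g f).2 ?_
  set s : ComplexPoints R → ℝ := fun x => ∑ i, ‖ComplexPoints.eval (g i) x‖ with hs
  set D : ComplexPoints R → ℝ := fun x => ∑ i, ‖ComplexPoints.eval (g i) x‖ ^ 2 with hD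
  have hsc : Continuous s := continuous_finsetSum _ fun i _ => (ComplexPoints.continuous_eval _).norm
  have hDc : Continuous D :=
    continuous_finsetSum _ fun i _ => (ComplexPoints.continuous_eval _).norm.pow 2
  have hs0 : ∀ x, 0 ≤ s x := fun x => Finset.sum_nonneg fun _ _ => norm_nonneg _
  have hD0 : ∀ x, 0 ≤ D x := fun x => Finset.sum_nonneg fun _ _ => sq_nonneg _
  have hgs : ∀ i x, ‖ComplexPoints.eval (g i) x‖ ≤ s x := fun i x =>
    Finset.single_le_sum (f := fun i => ‖ComplexPoints.eval (g i) x‖)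
      (fun _ _ => norm_nonneg _) (Finset.mem_univ i)
  have hsD : ∀ x, s x ^ 2 ≤ n * D x := fun x => by
    simpa using sq_sum_le_card_mul_sum_sq (s := Finset.univ)
      (f := fun i => ‖ComplexPoints.eval (g i) x‖)
  have hDs : ∀ x, D x = 0 → s x = 0 := fun x hx => by
    have := hsD x
    rw [hx, mul_zero] at this
    exact pow_eq_zero_iff two_ne_zero |>.1 (le_antisymm this (sq_nonneg _))
  have hf0 : ∀ x, s x = 0 → ComplexPoints.eval f x = 0 := fun x hx => by
    have := hC x
    change _ ≤ C x * s x ^ (N + 1) at this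
    rw [hx, zero_pow N.succ_ne_zero, mul_zero, ComplexPoints.eval_pow, norm_le_zero_iff] at this
    exact pow_eq_zero_iff hN.ne' |>.1 this
  -- Least-squares solution of `f = Σ qᵢ gᵢ`; division by zero gives the value `0` on the common
  -- zero set of the `gᵢ`, which is the right continuous extension.
  let q : Fin n → ComplexPoints R → ℂ := fun i x =>
    ComplexPoints.eval f x * starRingEnd ℂ (ComplexPoints.eval (g i) x) / (D x : ℂ)
  -- The exponent `N + 1` leaves one spare factor `s x`, which forces `q i` to tend to `0` at the
  -- common zeros.
  have hqle : ∀ i x, ‖q i x‖ ^ N ≤ C x * n ^ N * s x := by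
    intro i x
    rcases eq_or_ne (D x) 0 with h | h
    · simp only [q, h, Complex.ofReal_zero, div_zero, norm_zero, zero_pow hN.ne']
      exact mul_nonneg (mul_nonneg (hC0 x) (by positivity)) (hs0 x)
    have hDpos : 0 < D x := lt_of_le_of_ne (hD0 x) (Ne.symm h)
    have h1 : ‖q i x‖ = ‖ComplexPoints.eval f x‖ * ‖ComplexPoints.eval (g i) x‖ / D x := by
      simp only [q, norm_div, norm_mul, RCLike.norm_conj, Complex.norm_real, Real.norm_eq_abs,
        abs_of_pos hDpos]
    rw [h1, div_pow, div_le_iff₀ (pow_pos hDpos N), mul_pow, ← norm_pow, ← ComplexPoints.eval_pow]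
    calc _ ≤ (C x * s x ^ (N + 1)) * s x ^ N :=
          mul_le_mul (hC x) (pow_le_pow_left₀ (norm_nonneg _) (hgs i x) N) (by positivity)
            (mul_nonneg (hC0 x) (pow_nonneg (hs0 x) _))
      _ = C x * s x * (s x ^ 2) ^ N := by ring
      _ ≤ C x * s x * (n * D x) ^ N :=
          mul_le_mul_of_nonneg_left (pow_le_pow_left₀ (sq_nonneg _) (hsD x) N)
            (mul_nonneg (hC0 x) (hs0 x))
      _ = _ := by ring
  refine ⟨q, fun i => continuous_iff_continuousAt.2 fun x => ?_, fun x => ?_⟩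
  · by_cases h : D x = 0
    · have hqx : q i x = 0 := by simp [q, h]
      rw [ContinuousAt, hqx, tendsto_zero_iff_norm_tendsto_zero]
      have hlim : Filter.Tendsto (fun y => C y * n ^ N * s y) (𝓝 x) (𝓝 0) := by
        have : Continuous fun y => C y * n ^ N * s y := (hCc.mul continuous_const).mul hsc
        simpa [hDs x h] using this.tendsto x
      have hpow : Filter.Tendsto (fun y => ‖q i y‖ ^ N) (𝓝 x) (𝓝 0) :=
        squeeze_zero (fun y => by positivity) (hqle i) hlim
      have hroot := hpow.rpow_const (p := (N : ℝ)⁻¹) (Or.inr (by positivity))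
      rw [Real.zero_rpow (by positivity)] at hroot
      refine hroot.congr fun y => ?_
      exact Real.pow_rpow_inv_natCast (norm_nonneg _) hN.ne'
    · refine ContinuousAt.div ?_ (Complex.continuous_ofReal.comp hDc).continuousAt
        (by simpa using h)
      exact ((ComplexPoints.continuous_eval f).mul
        (Complex.continuous_conj.comp (ComplexPoints.continuous_eval (g i)))).continuousAt
  · by_cases h : D x = 0
    · simp [q, h, hf0 x (hDs x h)]
    · have h' : (D x : ℂ) ≠ 0 := by simpa using h
      have h2 : ∀ i, q i x * ComplexPoints.eval (g i) x =
          ComplexPoints.eval f x / D x * ((‖ComplexPoints.eval (g i) x‖ ^ 2 : ℝ) : ℂ) := fun i => by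
        simp only [q]
        rw [Complex.ofReal_pow, ← Complex.conj_mul']
        ring
      rw [Finset.sum_congr rfl fun i _ => h2 i, ← Finset.mul_sum, ← Complex.ofReal_sum]
      change _ = _ / _ * (D x : ℂ)
      rw [div_mul_cancel₀ _ h']

/-- The continuous closure is functorial. -/
theorem map_mem_continuousClosure {R S : Type u} [CommRing R] [Algebra ℂ R] [CommRing S]
    [Algebra ℂ S] (φ : R →ₐ[ℂ] S) {I : Ideal R} {J : Ideal S} (hIJ : ∀ g ∈ I, φ g ∈ J) {f : R}
    (hf : f ∈ continuousClosure I) : φ f ∈ continuousClosure J := by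
  let ψ : ComplexPoints S → ComplexPoints R := fun x => (show S →ₐ[ℂ] ℂ from x).comp φ
  have hψ : Continuous ψ := by
    refine continuous_induced_rng.2 (continuous_pi fun g => ?_)
    exact ComplexPoints.continuous_eval (φ g)
  let Ψ : C(ComplexPoints R, ℂ) →+* C(ComplexPoints S, ℂ) :=
    (ContinuousMap.compRightAlgHom ℂ ℂ ⟨ψ, hψ⟩).toRingHom
  have hcomp : ∀ g, Ψ (toContinuousFunctions R g) = toContinuousFunctions S (φ g) := fun g => rfl
  have h1 := Ideal.mem_map_of_mem Ψ (Ideal.mem_comap.1 hf)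
  rw [Ideal.map_map] at h1
  rw [continuousClosure, Ideal.mem_comap, ← hcomp]
  refine Ideal.map_le_iff_le_comap.2 (fun g hg => ?_) h1
  rw [Ideal.mem_comap, RingHom.comp_apply, hcomp]
  exact Ideal.mem_map_of_mem _ (hIJ g hg)

/-! ### The axes closure and the local algebra of rings of axes -/

theorem le_axesClosure (K : Type u) [Field K] {R : Type v} [CommRing R] (I : Ideal R) :
    I ≤ axesClosure K I := fun _ hf _ _ _ _ φ => Ideal.mem_map_of_mem φ hf

/-- The axes closure is functorial. -/
theorem map_mem_axesClosure (K : Type u) [Field K] {R S : Type v} [CommRing R] [CommRing S]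
    (φ : R →+* S) {I : Ideal R} {J : Ideal S} (hIJ : ∀ g ∈ I, φ g ∈ J) {f : R}
    (hf : f ∈ axesClosure K I) : φ f ∈ axesClosure K J := by
  intro T _ _ hT ψ
  have h := hf T hT (ψ.comp φ)
  refine Ideal.map_le_iff_le_comap.2 (fun g hg => ?_) h
  exact Ideal.mem_map_of_mem ψ (hIJ g hg)

/-- Two elements `j ∈ J` and `b ∈ m` with `f ≡ j b` modulo `q` exist if a power of `f` lies in a
higher power of `J` and `A ⧸ q` is a principal ideal domain. -/
theorem exists_sub_mul_mem_of_pow_mem {A : Type*} [CommRing A] [IsLocalRing A] {q : Ideal A}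
    [q.IsPrime] [IsPrincipalIdealRing (A ⧸ q)] {J : Ideal A} (hJ : J ≤ IsLocalRing.maximalIdeal A)
    {f : A} {N : ℕ} (hN : N ≠ 0) (hf : f ^ N ∈ J ^ (N + 1)) :
    ∃ j ∈ J, ∃ b ∈ IsLocalRing.maximalIdeal A, f - j * b ∈ q := by
  set π := Ideal.Quotient.mk q
  have hπ : Function.Surjective π := Ideal.Quotient.mk_surjective
  obtain ⟨a, ha⟩ := IsPrincipalIdealRing.principal (J.map π)
  obtain ⟨j, hj, rfl⟩ : ∃ j ∈ J, π j = a := by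
    refine (Ideal.mem_map_iff_of_surjective π hπ).1 ?_
    rw [ha]
    exact Submodule.mem_span_singleton_self a
  have hdvd : π j ^ (N + 1) ∣ π f ^ N := by
    have := Ideal.mem_map_of_mem π hf
    rwa [Ideal.map_pow, ha, ← Ideal.span, Ideal.span_singleton_pow, Ideal.mem_span_singleton,
      map_pow] at this
  obtain ⟨b, hb⟩ : π j ∣ π f :=
    (IsIntegrallyClosed.pow_dvd_pow_iff hN).1 ((pow_dvd_pow _ N.le_succ).trans hdvd)
  by_cases h0 : π j = 0
  · refine ⟨j, hj, 0, zero_mem _, ?_⟩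
    rw [mul_zero, sub_zero, ← Ideal.Quotient.eq_zero_iff_mem]
    change π f = 0
    rw [hb, h0, zero_mul]
  obtain ⟨b, rfl⟩ := hπ b
  refine ⟨j, hj, b, ?_, ?_⟩
  · obtain ⟨c, hc⟩ := hdvd
    rw [hb, mul_pow, pow_succ, mul_assoc] at hc
    have hbc := mul_left_cancel₀ (pow_ne_zero N h0) hc
    obtain ⟨c, rfl⟩ := hπ c
    rw [← map_pow, ← map_mul, Ideal.Quotient.mk_eq_mk_iff_sub_mem] at hbc
    have hqm : q ≤ IsLocalRing.maximalIdeal A := IsLocalRing.le_maximalIdeal (Ideal.IsPrime.ne_top')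
    have h1 := add_mem (hqm hbc) (Ideal.mul_mem_right c _ (hJ hj))
    rw [sub_add_cancel] at h1
    exact Ideal.IsPrime.mem_of_pow_mem inferInstance N h1
  · rw [← Ideal.Quotient.mk_eq_mk_iff_sub_mem]
    change π f = π _
    rw [hb, map_mul]

/-- By Nakayama's lemma, elements of the maximal ideal which can be interpolated modulo the ideals
`q` and the square of the maximal ideal can be interpolated modulo the ideals `q`. -/
theorem exists_sub_mem_of_transversal {A : Type*} [CommRing A] [IsLocalRing A] [IsNoetherianRing A]
    {s : Set (Ideal A)} (hs : s.Finite)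
    (htr : ∀ a : Ideal A → A, (∀ q ∈ s, a q ∈ IsLocalRing.maximalIdeal A) →
      ∃ x ∈ IsLocalRing.maximalIdeal A, ∀ q ∈ s, x - a q ∈ q ⊔ IsLocalRing.maximalIdeal A ^ 2)
    (a : Ideal A → A) (ha : ∀ q ∈ s, a q ∈ IsLocalRing.maximalIdeal A) :
    ∃ x ∈ IsLocalRing.maximalIdeal A, ∀ q ∈ s, x - a q ∈ q := by
  classical
  have := hs.fintype
  set m := IsLocalRing.maximalIdeal A with hm
  let Φ : A →ₗ[A] ((q : s) → A ⧸ q.1) := LinearMap.pi fun q => q.1.mkQ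
  let N' : Submodule A ((q : s) → A ⧸ q.1) :=
    Submodule.pi Set.univ fun q => Submodule.map q.1.mkQ m
  have hsingle : ∀ (q : s) (z : A), z ∈ m → Pi.single q (q.1.mkQ z) ∈ N' := by
    intro q z hz q' _
    by_cases h : q' = q
    · subst h
      rw [Pi.single_eq_same]
      exact Submodule.mem_map_of_mem hz
    · rw [Pi.single_eq_of_ne h]
      exact zero_mem _
  have hsq : ∀ (q : s) (z : A), z ∈ m ^ 2 → Pi.single q (q.1.mkQ z) ∈ m • N' := by
    intro q z hz
    rw [pow_two] at hz
    refine Submodule.mul_induction_on hz (fun u hu v hv => ?_) fun u v hu hv => ?_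
    · rw [← smul_eq_mul, map_smul, Pi.single_smul (f := fun q : s => A ⧸ q.1)]
      exact Submodule.smul_mem_smul hu (hsingle q v hv)
    · rw [map_add, Pi.single_add]
      exact add_mem hu hv
  -- Transversality says that `N'` is contained in the image of `m` plus `m • N'`, so Nakayama
  -- removes the second term.
  have key : N' ≤ Submodule.map Φ m := by
    refine Submodule.le_of_le_smul_of_le_jacobson_bot (I := m) (IsNoetherian.noetherian _)
      (IsLocalRing.maximalIdeal_le_jacobson _) ?_
    intro b hb
    choose c hc hcb using fun q : s => (hb q trivial : b q ∈ Submodule.map q.1.mkQ m)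
    obtain ⟨x, hx, hxc⟩ := htr (fun q => if h : q ∈ s then c ⟨q, h⟩ else 0) (by
      intro q hq
      simp only [dif_pos hq]
      exact hc _)
    have hxc' : ∀ q : s, ∃ z ∈ m ^ 2, x - c q - z ∈ q.1 := by
      intro q
      have := hxc q.1 q.2
      simp only [dif_pos q.2] at this
      obtain ⟨y, hy, z, hz, hyz⟩ := Submodule.mem_sup.1 this
      exact ⟨z, hz, by rw [← hyz]; simpa using hy⟩
    choose z hz hxz using hxc'
    have hb' : b = Φ x + -∑ q : s, Pi.single q (q.1.mkQ (z q)) := by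
      ext q
      rw [Finset.univ_sum_single (fun q : s => q.1.mkQ (z q))]
      rw [← hcb q]
      have h1 : q.1.mkQ (x - c q - z q) = 0 := by
        simpa using (Submodule.Quotient.mk_eq_zero q.1).2 (hxz q)
      rw [map_sub, map_sub] at h1
      change q.1.mkQ (c q) = q.1.mkQ x + -(q.1.mkQ (z q))
      rw [← sub_eq_zero, ← neg_eq_zero, ← h1]
      abel
    rw [hb']
    exact Submodule.add_mem_sup (Submodule.mem_map_of_mem hx)
      (neg_mem (sum_mem fun q _ => hsq q _ (hz q)))
  obtain ⟨x, hx, hxa⟩ := key (x := fun q => q.1.mkQ (a q.1))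
    fun q _ => Submodule.mem_map_of_mem (ha q.1 q.2)
  refine ⟨x, hx, fun q hq => ?_⟩
  have h1 : q.mkQ x = q.mkQ (a q) := congrFun hxa ⟨q, hq⟩
  exact (Submodule.Quotient.eq q).1 h1

/-- In a reduced Noetherian local ring whose components are regular of dimension at most one and
transversal, `f ^ N ∈ J ^ (N + 1)` implies `f ∈ J`. -/
theorem IsLocalRing.mem_of_pow_mem_of_transversal {A : Type*} [CommRing A] [IsLocalRing A]
    [IsNoetherianRing A] [IsReduced A] (hpid : ∀ q ∈ minimalPrimes A, IsPrincipalIdealRing (A ⧸ q))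
    (htr : ∀ a : Ideal A → A, (∀ q ∈ minimalPrimes A, a q ∈ IsLocalRing.maximalIdeal A) →
      ∃ x ∈ IsLocalRing.maximalIdeal A, ∀ q ∈ minimalPrimes A,
        x - a q ∈ q ⊔ IsLocalRing.maximalIdeal A ^ 2)
    {J : Ideal A} {f : A} {N : ℕ} (hf : f ^ N ∈ J ^ (N + 1)) : f ∈ J := by
  classical
  by_cases hJ : J = ⊤
  · rw [hJ]; trivial
  have hJm := IsLocalRing.le_maximalIdeal hJ
  have hN : N ≠ 0 := by
    rintro rfl
    rw [pow_zero, zero_add, pow_one, ← Ideal.eq_top_iff_one] at hf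
    exact hJ hf
  have hfin : (minimalPrimes A).Finite := minimalPrimes.finite_of_isNoetherianRing A
  -- The element `u` represents `(0, …, b, …, 0)` across the components, so `u * j` equals `f` on
  -- the component `q` and `0` on the others. Summing over `q` recovers `f`, by reducedness.
  have hex : ∀ q : Ideal A, ∃ j b u, q ∈ minimalPrimes A →
      j ∈ J ∧ f - j * b ∈ q ∧ u - b ∈ q ∧ ∀ q' ∈ minimalPrimes A, q' ≠ q → u ∈ q' := by
    intro q
    by_cases hq : q ∈ minimalPrimes A
    · have := hpid q hq
      have : q.IsPrime := hq.1.1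
      obtain ⟨j, hj, b, hb, hfjb⟩ := exists_sub_mul_mem_of_pow_mem (q := q) hJm hN hf
      obtain ⟨u, -, hu⟩ := exists_sub_mem_of_transversal hfin htr (fun q' => if q' = q then b else 0)
        (fun q' _ => by
          split_ifs
          exacts [hb, zero_mem _])
      refine ⟨j, b, u, fun _ => ⟨hj, hfjb, by simpa using hu q hq, fun q' hq' hne => ?_⟩⟩
      simpa [hne] using hu q' hq'
    · exact ⟨0, 0, 0, fun h => absurd h hq⟩
  choose j b u h using hex
  have hmem : ∑ q ∈ hfin.toFinset, u q * j q ∈ J :=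
    sum_mem fun q hq => Ideal.mul_mem_left _ _ (h q (hfin.mem_toFinset.1 hq)).1
  suffices f - ∑ q ∈ hfin.toFinset, u q * j q = 0 by rwa [sub_eq_zero.1 this]
  rw [← Ideal.mem_bot, ← Ideal.zero_eq_bot, ← nilradical_eq_zero A, nilradical, ← Ideal.sInf_minimalPrimes,
    Submodule.mem_sInf]
  intro q hq
  obtain ⟨-, h1, h2, -⟩ := h q hq
  rw [← Finset.add_sum_erase _ _ (hfin.mem_toFinset.2 hq)]
  have h3 : ∑ q' ∈ hfin.toFinset.erase q, u q' * j q' ∈ q := by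
    refine sum_mem fun q' hq' => Ideal.mul_mem_right _ _ ?_
    rw [Finset.mem_erase, hfin.mem_toFinset] at hq'
    exact (h q' hq'.2).2.2.2 q hq hq'.1.symm
  have h4 : f - (u q * j q + ∑ q' ∈ hfin.toFinset.erase q, u q' * j q') =
      (f - j q * b q) - (u q - b q) * j q - ∑ q' ∈ hfin.toFinset.erase q, u q' * j q' := by ring
  rw [h4]
  exact sub_mem (sub_mem h1 (Ideal.mul_mem_right _ _ h2)) h3

/-- A ring of axes is closed under the passage from `f ^ N ∈ J ^ (N + 1)` to `f ∈ J`. -/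
theorem IsRingOfAxes.mem_of_pow_mem {K : Type u} [Field K] {T : Type u} [CommRing T] [Algebra K T]
    (hT : IsRingOfAxes K T) {J : Ideal T} {f : T} {N : ℕ} (hf : f ^ N ∈ J ^ (N + 1)) : f ∈ J := by
  classical
  obtain ⟨P, hP⟩ := hT.exists_origin
  have := hT.finiteType
  have := hT.isReduced
  have : IsNoetherianRing T := Algebra.FiniteType.isNoetherianRing K T
  have hded : ∀ p ∈ minimalPrimes T, ∀ _ : p.IsPrime, IsDedekindDomain (T ⧸ p) := by
    intro p hp _
    have h1 : Ring.KrullDimLE 1 (T ⧸ p) := by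
      rw [Ring.krullDimLE_iff, Nat.cast_one, ← hT.dimension_one]
      exact ringKrullDim_le_of_surjective _ Ideal.Quotient.mk_surjective
    have h2 := hT.normal p hp
    have h3 : Ring.DimensionLEOne (T ⧸ p) := ⟨fun hne hprime => hprime.isMaximal_of_ne_bot hne⟩
    exact {}
  refine Ideal.mem_of_localization_maximal fun Q hQ => ?_
  set A := Localization.AtPrime Q
  set α := algebraMap T A
  set m := IsLocalRing.maximalIdeal A
  have hmem : ∀ x, α x ∈ m ↔ x ∈ Q := IsLocalization.AtPrime.to_map_mem_maximal_iff A Q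
  have hNA : IsNoetherianRing A := IsLocalization.isNoetherianRing Q.primeCompl A inferInstance
  have hmin : ∀ q : Ideal A, q ∈ minimalPrimes A ↔ q.comap α ∈ minimalPrimes T := by
    intro q
    have := IsLocalization.minimalPrimes_map Q.primeCompl A (⊥ : Ideal T)
    rw [Ideal.map_bot] at this
    exact Set.ext_iff.1 this q
  have hcomap : ∀ q : Ideal A, (q.comap α).map α = q := IsLocalization.map_under Q.primeCompl A
  have hle : ∀ q : Ideal A, q.IsPrime → q.comap α ≤ Q := fun q hq x hx =>
    (hmem x).1 (IsLocalRing.le_maximalIdeal hq.ne_top hx)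
  have hpow : α f ^ N ∈ J.map α ^ (N + 1) := by
    rw [← map_pow, ← Ideal.map_pow]
    exact Ideal.mem_map_of_mem α hf
  refine IsLocalRing.mem_of_pow_mem_of_transversal ?_ ?_ hpow
  · intro q hq
    have hqp : q.IsPrime := hq.1.1
    have hpp : (q.comap α).IsPrime := hqp.comap α
    have := hded _ ((hmin q).1 hq) hpp
    -- In this form the quotient is a localization of the Dedekind domain `T ⧸ q.comap α`; being
    -- local as well, it is a principal ideal ring.
    suffices IsPrincipalIdealRing (A ⧸ (q.comap α).map α) by rwa [hcomap] at this
    have hqp' : ((q.comap α).map α).IsPrime := (hcomap q).symm ▸ hqp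
    have hM : Algebra.algebraMapSubmonoid (T ⧸ q.comap α) Q.primeCompl ≤
        nonZeroDivisors (T ⧸ q.comap α) := by
      rintro _ ⟨s, hs, rfl⟩
      refine mem_nonZeroDivisors_of_ne_zero fun h => hs (hle q hqp ?_)
      exact Ideal.Quotient.eq_zero_iff_mem.1 h
    have hDed : IsDedekindDomain (A ⧸ (q.comap α).map α) :=
      IsLocalization.isDedekindDomain (T ⧸ q.comap α) hM _
    have hlr : IsLocalRing (A ⧸ (q.comap α).map α) :=
      .of_surjective' (Ideal.Quotient.mk _) Ideal.Quotient.mk_surjective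
    exact ((tfae_of_isNoetherianRing_of_isLocalRing_of_isDomain _).out 2 0).1 hDed
  · intro a ha
    by_cases hQP : Q = P
    · subst hQP
      -- Transversality is given in `T`, not in `A`. For `y = r / s` take `t = r * s'` with `s'`
      -- inverse to `s` modulo `Q`.
      have hlift : ∀ y ∈ m, ∃ t ∈ Q, α t - y ∈ m ^ 2 := by
        intro y hy
        obtain ⟨r, s, rfl⟩ := IsLocalization.exists_mk'_eq Q.primeCompl y
        have hr : r ∈ Q := (IsLocalization.AtPrime.mk'_mem_maximal_iff A Q r s).1 hy
        obtain ⟨s', hs'⟩ : ∃ s', s.1 * s' - 1 ∈ Q := by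
          let := Ideal.Quotient.field Q
          have hs0 : Ideal.Quotient.mk Q s.1 ≠ 0 := fun h =>
            s.2 (Ideal.Quotient.eq_zero_iff_mem.1 h)
          obtain ⟨s', hs'⟩ := Ideal.Quotient.mk_surjective (Ideal.Quotient.mk Q s.1)⁻¹
          refine ⟨s', Ideal.Quotient.mk_eq_mk_iff_sub_mem _ _ |>.1 ?_⟩
          rw [map_mul, hs', mul_inv_cancel₀ hs0, map_one]
        refine ⟨r * s', Ideal.mul_mem_right _ _ hr, ?_⟩
        have h1 : α s.1 * (α (r * s') - IsLocalization.mk' A r s) = α r * α (s.1 * s' - 1) := by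
          rw [mul_sub, mul_comm (α s.1) (IsLocalization.mk' A r s), IsLocalization.mk'_spec]
          simp only [map_mul, map_sub, map_one]
          ring
        have h2 : IsUnit (α s.1) := IsLocalization.map_units A s
        rw [← Ideal.unit_mul_mem_iff_mem _ h2, h1, pow_two]
        exact Ideal.mul_mem_mul ((hmem _).2 hr) ((hmem _).2 hs')
      have hlift' : ∀ q : Ideal A, ∃ t ∈ Q, q ∈ minimalPrimes A → α t - a q ∈ m ^ 2 := by
        intro q
        by_cases hq : q ∈ minimalPrimes A
        · obtain ⟨t, ht, h⟩ := hlift _ (ha q hq)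
          exact ⟨t, ht, fun _ => h⟩
        · exact ⟨0, zero_mem _, fun h => absurd h hq⟩
      choose t htQ hta using hlift'
      obtain ⟨x, hx, hxt⟩ := hP.transversal (fun p => t (p.map α)) fun p _ => htQ _
      refine ⟨α x, (hmem x).2 hx, fun q hq => ?_⟩
      have h1 := Ideal.mem_map_of_mem α (hxt _ ((hmin q).1 hq))
      rw [hcomap, Ideal.map_sup, hcomap, Ideal.map_pow, map_sub] at h1
      have h2 : Q.map α = m := IsLocalization.AtPrime.map_eq_maximalIdeal Q A
      rw [h2] at h1
      have h3 := add_mem h1 (Ideal.mem_sup_right (hta q hq) : _ ∈ q ⊔ m ^ 2)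
      rwa [sub_add_sub_cancel] at h3
    -- Away from the origin at most one component passes through `Q`, so there is nothing to
    -- interpolate.
    · have huniq : ∀ q ∈ minimalPrimes A, ∀ q' ∈ minimalPrimes A, q = q' := by
        intro q hq q' hq'
        by_contra hne
        have hne' : q.comap α ≠ q'.comap α := fun h => hne (by rw [← hcomap q, h, hcomap])
        exact hQP (hP.meet_only _ ((hmin q).1 hq) _ ((hmin q').1 hq') hne' Q hQ.isPrime
          (hle q hq.1.1) (hle q' hq'.1.1))
      rcases Set.eq_empty_or_nonempty (minimalPrimes A) with h | ⟨q₀, hq₀⟩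
      · exact ⟨0, zero_mem _, fun q hq => (Set.eq_empty_iff_forall_notMem.1 h q hq).elim⟩
      · refine ⟨a q₀, ha q₀ hq₀, fun q hq => ?_⟩
        rw [huniq q hq q₀ hq₀, sub_self]
        exact zero_mem _

/-! ### The coordinate axes as a ring of axes -/

/-- The embedding dimension at a maximal ideal `P` is the number of elements of `P` which form a
basis modulo `P ^ 2`. -/
theorem embeddingDimensionAt_eq_card {T ι : Type*} [CommRing T] [Fintype ι] {P : Ideal T}
    (hP : P.IsMaximal) (x : ι → T) (hx : ∀ k, x k ∈ P)
    (hindep : ∀ r : ι → T, ∑ k, r k * x k ∈ P ^ 2 → ∀ k, r k ∈ P)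
    (hspan : ∀ h ∈ P, ∃ r : ι → T, h - ∑ k, r k * x k ∈ P ^ 2) :
    embeddingDimensionAt P = Fintype.card ι := by
  have hnt : Nontrivial (T ⧸ P) := Ideal.Quotient.nontrivial_iff.2 hP.ne_top
  let y : ι → P := fun k => ⟨x k, hx k⟩
  have hsum : ∀ r : ι → T,
      ∑ k, Ideal.Quotient.mk P (r k) • P.toCotangent (y k) = P.toCotangent (∑ k, r k • y k) := by
    intro r
    rw [map_sum]
    refine Finset.sum_congr rfl fun k _ => ?_
    rw [map_smul]
    rfl
  have hcoe : ∀ r : ι → T, ((∑ k, r k • y k : P) : T) = ∑ k, r k * x k := fun r => by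
    simp [y]
  have hLI : LinearIndependent (T ⧸ P) fun k => P.toCotangent (y k) := by
    rw [Fintype.linearIndependent_iff]
    intro g hg k
    choose r hr using fun k => Ideal.Quotient.mk_surjective (g k)
    simp only [← hr] at hg ⊢
    rw [hsum, Ideal.toCotangent_eq_zero, hcoe] at hg
    exact Ideal.Quotient.eq_zero_iff_mem.2 (hindep r hg k)
  have hspan' : ⊤ ≤ Submodule.span (T ⧸ P) (Set.range fun k => P.toCotangent (y k)) := by
    rintro z -
    obtain ⟨h, rfl⟩ := P.toCotangent_surjective z
    obtain ⟨r, hr⟩ := hspan h.1 h.2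
    have : P.toCotangent h = ∑ k, Ideal.Quotient.mk P (r k) • P.toCotangent (y k) := by
      rw [hsum, ← sub_eq_zero, ← map_sub, Ideal.toCotangent_eq_zero, Submodule.coe_sub, hcoe]
      exact hr
    rw [this]
    exact sum_mem fun k _ => Submodule.smul_mem _ _ (Submodule.subset_span ⟨k, rfl⟩)
  exact Module.finrank_eq_card_basis (Module.Basis.mk hLI hspan')

/-- The coordinate ring of the coordinate axes in affine space: the families of polynomials in one
variable which have the same constant term. -/
def coordinateAxes (K : Type u) [Field K] (ι : Type) :
    Subalgebra (Polynomial K) (ι → Polynomial K) where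
  carrier := {h | ∀ k l, (h k).coeff 0 = (h l).coeff 0}
  mul_mem' := by
    intro a b ha hb k l
    simp only [Pi.mul_apply, Polynomial.mul_coeff_zero, ha k l, hb k l]
  add_mem' := by
    intro a b ha hb k l
    simp only [Pi.add_apply, Polynomial.coeff_add, ha k l, hb k l]
  algebraMap_mem' := fun _ _ _ => rfl

namespace coordinateAxes

variable {K : Type u} [Field K] {ι : Type}

/-- The restriction of functions to one of the axes. -/
noncomputable def proj (k : ι) : coordinateAxes K ι →+* Polynomial K :=
  (Pi.evalRingHom _ k).comp (coordinateAxes K ι).toSubring.subtype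

theorem ext_proj {g h : coordinateAxes K ι} (H : ∀ k, proj k g = proj k h) : g = h :=
  Subtype.ext (funext H)

theorem coeff_zero_proj (h : coordinateAxes K ι) (k l : ι) :
    (proj k h).coeff 0 = (proj l h).coeff 0 := h.2 k l

theorem proj_surjective (k : ι) : Function.Surjective (proj (K := K) k) := fun g =>
  ⟨⟨fun _ => g, fun _ _ => rfl⟩, rfl⟩

/-- The family of polynomials without constant term, as a function on the axes. -/
def ofFamily (g : ι → Polynomial K) (hg : ∀ k, (g k).coeff 0 = 0) : coordinateAxes K ι :=
  ⟨g, fun k l => (hg k).trans (hg l).symm⟩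

theorem proj_ofFamily (g : ι → Polynomial K) (hg : ∀ k, (g k).coeff 0 = 0) (k : ι) :
    proj k (ofFamily g hg) = g k := rfl

/-- A polynomial without constant term on one axis, extended by zero. -/
noncomputable def single [DecidableEq ι] (k : ι) (g : Polynomial K) (hg : g.coeff 0 = 0) : coordinateAxes K ι :=
  ofFamily (Pi.single k g) fun l => by
    by_cases h : l = k
    · subst h; simpa using hg
    · simp [h]

theorem proj_single_self [DecidableEq ι] (k : ι) (g : Polynomial K) (hg : g.coeff 0 = 0) :
    proj k (single k g hg) = g := Pi.single_eq_same _ _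

theorem proj_single_of_ne [DecidableEq ι] {k l : ι} (h : l ≠ k) (g : Polynomial K)
    (hg : g.coeff 0 = 0) : proj l (single k g hg) = 0 := Pi.single_eq_of_ne h _

theorem ker_proj_le_iff [DecidableEq ι] {k l : ι} :
    RingHom.ker (proj (K := K) k) ≤ RingHom.ker (proj (K := K) l) ↔ k = l := by
  refine ⟨fun h => ?_, fun h => h ▸ le_rfl⟩
  by_contra hkl
  have h1 : single l Polynomial.X Polynomial.coeff_X_zero ∈ RingHom.ker (proj (K := K) k) :=
    proj_single_of_ne hkl _ _
  have h2 := h h1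
  rw [RingHom.mem_ker, proj_single_self] at h2
  exact Polynomial.X_ne_zero h2

/-- The finitely many kernels intersect in zero, and a prime containing a finite intersection
contains one of its members. -/
theorem exists_ker_proj_le [Finite ι] (Q : Ideal (coordinateAxes K ι)) (hQ : Q.IsPrime) :
    ∃ k, RingHom.ker (proj k) ≤ Q := by
  have := Fintype.ofFinite ι
  have h : Finset.univ.inf (fun k => RingHom.ker (proj (K := K) (ι := ι) k)) ≤ Q := by
    intro x hx
    have : x = 0 := ext_proj fun k => by
      have := Finset.inf_le (f := fun k => RingHom.ker (proj (K := K) (ι := ι) k))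
        (Finset.mem_univ k) hx
      rw [map_zero]
      exact this
    rw [this]
    exact zero_mem _
  obtain ⟨k, -, hk⟩ := (Ideal.IsPrime.inf_le' hQ).1 h
  exact ⟨k, hk⟩

theorem mem_minimalPrimes_iff [Finite ι] {p : Ideal (coordinateAxes K ι)} :
    p ∈ minimalPrimes (coordinateAxes K ι) ↔ ∃ k, RingHom.ker (proj k) = p := by
  classical
  constructor
  · intro hp
    obtain ⟨k, hk⟩ := exists_ker_proj_le p hp.1.1
    exact ⟨k, le_antisymm hk (hp.2 ⟨RingHom.ker_isPrime _, bot_le⟩ hk)⟩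
  · rintro ⟨k, rfl⟩
    refine ⟨⟨RingHom.ker_isPrime _, bot_le⟩, fun Q hQ hle => ?_⟩
    obtain ⟨l, hl⟩ := exists_ker_proj_le Q hQ.1
    rwa [← ker_proj_le_iff.1 (hl.trans hle)]

/-- A submodule of the finite free module `ι → K[X]` over the Noetherian ring `K[X]` is finite. -/
theorem finiteType [Finite ι] : Algebra.FiniteType K (coordinateAxes K ι) := by
  have h1 : Module.Finite (Polynomial K) (coordinateAxes K ι) :=
    inferInstanceAs (Module.Finite (Polynomial K) (Subalgebra.toSubmodule (coordinateAxes K ι)))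
  have h2 : Algebra.FiniteType (Polynomial K) (coordinateAxes K ι) := inferInstance
  exact Algebra.FiniteType.trans (S := Polynomial K) inferInstance h2

theorem isReduced : IsReduced (coordinateAxes K ι) :=
  isReduced_of_injective (coordinateAxes K ι).toSubring.subtype Subtype.val_injective

theorem ringKrullDim_eq_one [Finite ι] [Nonempty ι] : ringKrullDim (coordinateAxes K ι) = 1 := by
  obtain ⟨k₀⟩ := ‹Nonempty ι›
  refine le_antisymm ?_ ?_
  · rw [← Nat.cast_one, ← Ring.krullDimLE_iff]
    refine .mk₁ fun Q hQ => ?_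
    obtain ⟨k, hk⟩ := exists_ker_proj_le Q hQ
    have hcm : (Q.map (proj k)).comap (proj k) = Q := by
      rw [Ideal.comap_map_of_surjective' _ (proj_surjective k), sup_eq_left.2 hk]
    have hpr : (Q.map (proj k)).IsPrime := Ideal.map_isPrime_of_surjective (proj_surjective k) hk
    by_cases h0 : Q.map (proj k) = ⊥
    · left
      rw [h0] at hcm
      exact mem_minimalPrimes_iff.2 ⟨k, hcm⟩
    · right
      have := hpr.isMaximal h0
      rw [← hcm]
      exact Ideal.comap_isMaximal_of_surjective _ (proj_surjective k)
  · rw [← IsPrincipalIdealRing.ringKrullDim_eq_one (Polynomial K) (Polynomial.not_isField K)]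
    exact ringKrullDim_le_of_surjective _ (proj_surjective k₀)

/-- The value at the origin of a function on the axes. -/
noncomputable def value (k₀ : ι) : coordinateAxes K ι →+* K :=
  Polynomial.constantCoeff.comp (proj k₀)

theorem value_eq (k₀ k : ι) (h : coordinateAxes K ι) : value k₀ h = (proj k h).coeff 0 :=
  coeff_zero_proj h k₀ k

theorem value_surjective (k₀ : ι) : Function.Surjective (value (K := K) k₀) := fun c =>
  ⟨algebraMap _ _ (Polynomial.C c), Polynomial.coeff_C_zero⟩

theorem mem_ker_value_iff {k₀ : ι} {h : coordinateAxes K ι} :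
    h ∈ RingHom.ker (value k₀) ↔ ∀ k, (proj k h).coeff 0 = 0 :=
  ⟨fun hh k => (value_eq k₀ k h).symm.trans hh, fun hh => hh k₀⟩

theorem isMaximal_ker_value (k₀ : ι) : (RingHom.ker (value (K := K) k₀)).IsMaximal :=
  RingHom.ker_isMaximal_of_surjective _ (value_surjective k₀)

/-- Vanishing to order two on every axis suffices because one factor `X` can be split off on each
axis separately. This makes the cotangent space readable from linear coefficients. -/
theorem mem_ker_value_sq_iff [Finite ι] {k₀ : ι} {h : coordinateAxes K ι}
    (hh : h ∈ RingHom.ker (value k₀)) :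
    h ∈ RingHom.ker (value k₀) ^ 2 ↔ ∀ k, (proj k h).coeff 1 = 0 := by
  classical
  have := Fintype.ofFinite ι
  rw [mem_ker_value_iff] at hh
  constructor
  · intro h2 k
    rw [pow_two] at h2
    refine Submodule.mul_induction_on h2 (fun a ha b hb => ?_) fun a b ha hb => ?_
    · rw [map_mul, Polynomial.mul_coeff_one, mem_ker_value_iff.1 ha, mem_ker_value_iff.1 hb]
      simp
    · rw [map_add, Polynomial.coeff_add, ha, hb, add_zero]
  · intro h1
    have hd : ∀ k, ((proj k h).divX).coeff 0 = 0 := fun k => by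
      rw [Polynomial.coeff_divX, zero_add, h1]
    have : h = ∑ k, single k Polynomial.X Polynomial.coeff_X_zero *
        ofFamily (fun k => (proj k h).divX) hd := by
      refine ext_proj fun l => ?_
      rw [map_sum, Finset.sum_eq_single l]
      · rw [map_mul, proj_single_self, proj_ofFamily]
        have := Polynomial.X_mul_divX_add (proj l h)
        rw [hh l, Polynomial.C_0, add_zero] at this
        exact this.symm
      · intro k _ hk
        rw [map_mul, proj_single_of_ne hk.symm, zero_mul]
      · simp
    rw [this, pow_two]
    refine sum_mem fun k _ => Ideal.mul_mem_mul ?_ ?_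
    · refine mem_ker_value_iff.2 fun l => ?_
      by_cases hl : l = k
      · subst hl; rw [proj_single_self, Polynomial.coeff_X_zero]
      · rw [proj_single_of_ne hl, Polynomial.coeff_zero]
    · exact mem_ker_value_iff.2 hd

theorem embeddingDimensionAt_ker_value [Fintype ι] (k₀ : ι) :
    embeddingDimensionAt (RingHom.ker (value (K := K) k₀)) = Fintype.card ι := by
  classical
  have hproj : ∀ (r : ι → coordinateAxes K ι) l,
      proj l (∑ k, r k * single k Polynomial.X Polynomial.coeff_X_zero) =
        proj l (r l) * Polynomial.X := by
    intro r l
    rw [map_sum, Finset.sum_eq_single l]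
    · rw [map_mul, proj_single_self]
    · intro k _ hk
      rw [map_mul, proj_single_of_ne hk.symm, mul_zero]
    · simp
  have hmem : ∀ r : ι → coordinateAxes K ι,
      ∑ k, r k * single k Polynomial.X Polynomial.coeff_X_zero ∈ RingHom.ker (value k₀) :=
    fun r => mem_ker_value_iff.2 fun l => by rw [hproj, Polynomial.coeff_mul_X_zero]
  refine embeddingDimensionAt_eq_card (isMaximal_ker_value k₀)
    (fun k => single k Polynomial.X Polynomial.coeff_X_zero) (fun k => ?_) (fun r hr k => ?_)
    fun h hh => ?_
  · refine mem_ker_value_iff.2 fun l => ?_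
    by_cases hl : l = k
    · subst hl; rw [proj_single_self, Polynomial.coeff_X_zero]
    · rw [proj_single_of_ne hl, Polynomial.coeff_zero]
  · have := (mem_ker_value_sq_iff (hmem r)).1 hr k
    rw [hproj, Polynomial.coeff_mul_X] at this
    rw [RingHom.mem_ker, value_eq k₀ k]
    exact this
  · refine ⟨fun k => algebraMap _ _ (Polynomial.C ((proj k h).coeff 1)), ?_⟩
    rw [mem_ker_value_sq_iff (sub_mem hh (hmem _))]
    intro k
    rw [map_sub, hproj, Polynomial.coeff_sub, Polynomial.coeff_mul_X]
    change _ - (Polynomial.C ((proj k h).coeff 1)).coeff 0 = 0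
    rw [Polynomial.coeff_C_zero, sub_self]

theorem isOriginOfAxes [Finite ι] (k₀ : ι) : IsOriginOfAxes (RingHom.ker (value (K := K) k₀)) where
  isMaximal := isMaximal_ker_value k₀
  le_origin := by
    intro p hp
    obtain ⟨k, rfl⟩ := mem_minimalPrimes_iff.1 hp
    intro h hh
    rw [RingHom.mem_ker] at hh
    rw [RingHom.mem_ker, value_eq k₀ k, hh, Polynomial.coeff_zero]
  meet_only := by
    classical
    intro p hp q hq hpq Q hQ hpQ hqQ
    obtain ⟨k, rfl⟩ := mem_minimalPrimes_iff.1 hp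
    obtain ⟨l, rfl⟩ := mem_minimalPrimes_iff.1 hq
    have hkl : l ≠ k := fun h => hpq (by rw [h])
    -- A function vanishing at the origin splits into its part on axis `k`, zero on axis `l`, and a
    -- remainder that is zero on axis `k`.
    refine ((isMaximal_ker_value k₀).eq_of_le hQ.ne_top fun h hh => ?_).symm
    rw [mem_ker_value_iff] at hh
    have h1 : single k (proj k h) (hh k) ∈ Q := hqQ (proj_single_of_ne hkl _ _)
    have h2 : h - single k (proj k h) (hh k) ∈ Q := hpQ (by
      rw [RingHom.mem_ker, map_sub, proj_single_self, sub_self])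
    have := add_mem h2 h1
    rwa [sub_add_cancel] at this
  transversal := by
    intro a ha
    have h0 : ∀ k, (proj k (a (RingHom.ker (proj k)))).coeff 0 = 0 := fun k =>
      mem_ker_value_iff.1 (ha _ (mem_minimalPrimes_iff.2 ⟨k, rfl⟩)) k
    refine ⟨ofFamily _ h0, mem_ker_value_iff.2 h0, fun p hp => ?_⟩
    obtain ⟨k, rfl⟩ := mem_minimalPrimes_iff.1 hp
    refine Ideal.mem_sup_left ?_
    rw [RingHom.mem_ker, map_sub, proj_ofFamily, sub_self]
  embeddingDimension_eq := by
    classical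
    have := Fintype.ofFinite ι
    have h : minimalPrimes (coordinateAxes K ι) = Set.range fun k => RingHom.ker (proj k) :=
      Set.ext fun p => mem_minimalPrimes_iff
    rw [embeddingDimensionAt_ker_value, h, ← Set.image_univ, Set.ncard_image_of_injective,
      Set.ncard_univ, Nat.card_eq_fintype_card]
    exact fun k l hkl => ker_proj_le_iff.1 (le_of_eq hkl)

theorem isRingOfAxes [Finite ι] [Nonempty ι] : IsRingOfAxes K (coordinateAxes K ι) where
  finiteType := finiteType
  isReduced := isReduced
  dimension_one := ringKrullDim_eq_one
  normal := by
    intro p hp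
    obtain ⟨k, rfl⟩ := mem_minimalPrimes_iff.1 hp
    exact IsIntegrallyClosed.of_equiv
      (RingHom.quotientKerEquivOfSurjective (proj_surjective k)).symm
  exists_origin := ⟨_, isOriginOfAxes (Classical.arbitrary ι)⟩

end coordinateAxes

/-! ### Torus action and reduction to monomials -/

theorem exists_injective_monomial_values (m : ℕ) :
    ∃ c : Fin m → ℂ, Function.Injective fun γ : Fin m →₀ ℕ => ∏ i, c i ^ γ i := by
  -- Distinct primes: injectivity is unique factorization.
  refine ⟨fun i => (Nat.nth Nat.Prime i : ℂ), fun γ δ h => ?_⟩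
  have hp : ∀ i : Fin m, (Nat.nth Nat.Prime i).Prime := fun i => Nat.prime_nth_prime i
  have hfac : ∀ (γ : Fin m →₀ ℕ) (i : Fin m),
      (∏ j : Fin m, Nat.nth Nat.Prime j ^ γ j).factorization (Nat.nth Nat.Prime i) = γ i := by
    intro γ i
    rw [Nat.factorization_prod fun j _ => pow_ne_zero _ (hp j).ne_zero, Finsupp.finsetSum_apply,
      Finset.sum_eq_single i]
    · rw [(hp i).factorization_pow, Finsupp.single_eq_same]
    · intro j _ hj
      rw [(hp j).factorization_pow, Finsupp.single_apply, if_neg]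
      intro h
      exact hj (Fin.ext (Nat.nth_injective Nat.infinite_setOfPred_prime h))
    · simp
  have h' : ∏ j : Fin m, Nat.nth Nat.Prime j ^ γ j = ∏ j : Fin m, Nat.nth Nat.Prime j ^ δ j := by
    dsimp only at h
    exact_mod_cast h
  ext i
  rw [← hfac γ i, h', hfac]

/-- The action of a point of the torus on polynomials by rescaling the variables. -/
noncomputable def rescale {m : ℕ} (c : Fin m → ℂ) :
    MvPolynomial (Fin m) ℂ →ₐ[ℂ] MvPolynomial (Fin m) ℂ :=
  MvPolynomial.aeval fun i => MvPolynomial.C (c i) * MvPolynomial.X i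

theorem rescale_monomial {m : ℕ} (c : Fin m → ℂ) (γ : Fin m →₀ ℕ) (b : ℂ) :
    rescale c (MvPolynomial.monomial γ b) = MvPolynomial.monomial γ ((∏ i, c i ^ γ i) * b) := by
  rw [rescale, MvPolynomial.aeval_monomial, MvPolynomial.algebraMap_eq,
    Finsupp.prod_fintype _ _ (by simp)]
  simp only [mul_pow, Finset.prod_mul_distrib, ← map_pow, ← map_prod]
  rw [MvPolynomial.monomial_eq, Finsupp.prod_fintype _ _ (by simp), map_mul]
  ring

/-- An ideal stable under a rescaling with distinct values on monomials contains the monomials of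
its elements. -/
theorem monomial_mem_of_rescale_stable {m : ℕ} {c : Fin m → ℂ}
    (hc : Function.Injective fun γ : Fin m →₀ ℕ => ∏ i, c i ^ γ i)
    {V : Ideal (MvPolynomial (Fin m) ℂ)} (hV : ∀ f ∈ V, rescale c f ∈ V)
    {f : MvPolynomial (Fin m) ℂ} (hf : f ∈ V) {γ : Fin m →₀ ℕ} (hγ : γ ∈ f.support) :
    MvPolynomial.monomial γ (1 : ℂ) ∈ V := by
  classical
  have hscale : ∀ (γ : Fin m →₀ ℕ) (b t : ℂ), MvPolynomial.monomial γ b ∈ V →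
      MvPolynomial.monomial γ (t * b) ∈ V := fun γ b t h => by
    rw [← MvPolynomial.C_mul_monomial]
    exact V.mul_mem_left _ h
  have key : ∀ (s : Finset (Fin m →₀ ℕ)) (b : (Fin m →₀ ℕ) → ℂ),
      ∑ γ ∈ s, MvPolynomial.monomial γ (b γ) ∈ V → ∀ γ ∈ s, MvPolynomial.monomial γ (b γ) ∈ V := by
    intro s
    induction s using Finset.induction_on with
    | empty => simp
    | insert δ s hδ ih =>
      intro b hb
      have hs : ∀ γ ∈ s, MvPolynomial.monomial γ (b γ) ∈ V := by
        -- Monomials are eigenvectors of `rescale c` with distinct eigenvalues; subtracting the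
        -- eigenvalue of `δ` times the sum removes the `δ`-term and only rescales the others by
        -- nonzero factors.
        have h1 : ∑ γ ∈ s, MvPolynomial.monomial γ
            (((∏ i, c i ^ γ i) - ∏ i, c i ^ δ i) * b γ) ∈ V := by
          convert! sub_mem (hV _ hb) (V.mul_mem_left (MvPolynomial.C (∏ i, c i ^ δ i)) hb) using 1
          rw [map_sum, Finset.mul_sum, ← Finset.sum_sub_distrib, Finset.sum_insert hδ]
          simp only [rescale_monomial, MvPolynomial.C_mul_monomial, sub_self, zero_add, sub_mul,
            map_sub]
        intro γ hγ
        have hne : (∏ i, c i ^ γ i) - ∏ i, c i ^ δ i ≠ 0 :=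
          sub_ne_zero.2 fun h => hδ (hc h ▸ hγ)
        have h2 := hscale γ _ ((∏ i, c i ^ γ i) - ∏ i, c i ^ δ i)⁻¹ (ih _ h1 γ hγ)
        rwa [inv_mul_cancel_left₀ hne] at h2
      intro γ hγ
      rcases Finset.mem_insert.1 hγ with rfl | hγ
      · rw [Finset.sum_insert hδ] at hb
        exact (V.add_mem_iff_left (sum_mem hs)).1 hb
      · exact hs γ hγ
  have h1 := key f.support (fun γ => f.coeff γ)
    (by rw [MvPolynomial.support_sum_monomial_coeff]; exact hf) γ hγ
  have h2 := hscale γ _ (f.coeff γ)⁻¹ h1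
  rwa [inv_mul_cancel₀ (MvPolynomial.mem_support_iff.1 hγ)] at h2

theorem IsMonomialIdeal.rescale_mem {m : ℕ} {I : Ideal (MvPolynomial (Fin m) ℂ)}
    (hI : IsMonomialIdeal I) (c : Fin m → ℂ) {f : MvPolynomial (Fin m) ℂ} (hf : f ∈ I) :
    rescale c f ∈ I := by
  obtain ⟨S, rfl⟩ := hI
  have : Ideal.span ((fun γ => MvPolynomial.monomial γ (1 : ℂ)) '' S) ≤
      (Ideal.span ((fun γ => MvPolynomial.monomial γ (1 : ℂ)) '' S)).comap (rescale c) := by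
    rw [Ideal.span_le]
    rintro _ ⟨γ, hγ, rfl⟩
    rw [SetLike.mem_coe, Ideal.mem_comap, rescale_monomial, ← MvPolynomial.C_mul_monomial]
    exact Ideal.mul_mem_left _ _ (Ideal.subset_span ⟨γ, hγ, rfl⟩)
  exact this hf

/-! ### Excluding monomials by test curves -/

/-- For a monomial outside a primary monomial ideal and a supporting weight, there are points at
which finitely many monomials in the ideal can be separated from the given one. -/
theorem exists_separating_polynomial {m : ℕ} {I : Ideal (MvPolynomial (Fin m) ℂ)}
    (hI : I.IsPrimary) {γ : Fin m →₀ ℕ} (hγ : γ ∉ exponentSet I) {a : Fin m → ℕ} {d : ℕ}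
    (hd : 0 < d) (ha : ∀ δ ∈ exponentSet I, d ≤ weightedDegree a δ)
    {G : Finset (Fin m →₀ ℕ)} (hG : (G : Set _) ⊆ exponentSet I) :
    ∃ (c : Fin m → ℂ) (p : Polynomial ℂ), (∀ i, a i = 0 → c i = 1) ∧
      p.eval (∏ i, c i ^ γ i) ≠ 0 ∧ ∀ δ ∈ G, p.eval (∏ i, c i ^ δ i) = 0 := by
  classical
  obtain ⟨c, hc⟩ := exists_injective_monomial_values m
  let c' : Fin m → ℂ := fun i => if a i = 0 then 1 else c i
  let mask : (Fin m →₀ ℕ) → (Fin m →₀ ℕ) := fun δ => δ.filter fun i => a i ≠ 0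
  have hmask : ∀ δ : Fin m →₀ ℕ, ∏ i, c' i ^ δ i = ∏ i, c i ^ mask δ i := fun δ => by
    refine Finset.prod_congr rfl fun i _ => ?_
    by_cases h : a i = 0
    · simp [c', mask, h]
    · simp [c', mask, h]
  have hne : ∀ δ ∈ G, ∏ i, c' i ^ γ i ≠ ∏ i, c' i ^ δ i := by
    intro δ hδ heq
    rw [hmask, hmask] at heq
    have hmaskeq : mask γ = mask δ := hc heq
    set rest := δ.filter fun i => ¬ a i ≠ 0
    have hsplit : mask δ + rest = δ := δ.filter_add_filter_not _
    have h0 : weightedDegree a rest = 0 := by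
      refine Finset.sum_eq_zero fun i _ => ?_
      by_cases h : a i = 0
      · rw [h, zero_mul]
      · simp [rest, h]
    have hmem : MvPolynomial.monomial (mask δ) (1 : ℂ) * MvPolynomial.monomial rest 1 ∈ I := by
      rw [MvPolynomial.monomial_mul, hsplit, mul_one]
      exact hG hδ
    -- Primariness splits `z^δ` into its parts on and off the support of `a`. Either the first part
    -- lies in `I`, and then so does its multiple `z^γ`, or a power of the second does, although its
    -- weight is `0 < d`.
    rcases (Ideal.isPrimary_iff.1 hI).2 hmem with h | ⟨n, hn⟩
    · refine hγ (isUpperSet_exponentSet I ?_ h)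
      rw [← hmaskeq]
      intro i
      by_cases h : a i = 0 <;> simp [mask, h]
    · rw [MvPolynomial.monomial_pow, one_pow] at hn
      have h1 := ha _ hn
      have h2 : weightedDegree a (n • rest) = n * weightedDegree a rest := by
        simp only [weightedDegree, Finset.mul_sum, Finsupp.smul_apply, smul_eq_mul]
        exact Finset.sum_congr rfl fun i _ => by ring
      rw [h2, h0] at h1
      omega
  refine ⟨c', ∏ δ ∈ G, (Polynomial.X - Polynomial.C (∏ i, c' i ^ δ i)), fun i h => by simp [c', h],
    ?_, fun δ hδ => ?_⟩
  · rw [Polynomial.eval_prod, Finset.prod_ne_zero_iff]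
    intro δ hδ
    rw [Polynomial.eval_sub, Polynomial.eval_X, Polynomial.eval_C]
    exact sub_ne_zero.2 (hne δ hδ)
  · rw [Polynomial.eval_prod]
    exact Finset.prod_eq_zero hδ
      (by rw [Polynomial.eval_sub, Polynomial.eval_X, Polynomial.eval_C, sub_self])

/-- The curve `t ↦ (c₁ᵏ t ^ a₁, …, cₘᵏ t ^ aₘ)` in affine space. -/
noncomputable def monomialCurve {m : ℕ} (c : Fin m → ℂ) (a : Fin m → ℕ) (k : ℕ) (t : ℂ) :
    ComplexPoints (MvPolynomial (Fin m) ℂ) :=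
  (MvPolynomial.aeval fun i => c i ^ k * t ^ a i : MvPolynomial (Fin m) ℂ →ₐ[ℂ] ℂ)

theorem continuous_monomialCurve {m : ℕ} (c : Fin m → ℂ) (a : Fin m → ℕ) (k : ℕ) :
    Continuous (monomialCurve c a k) := by
  refine continuous_induced_rng.2 (continuous_pi fun f => ?_)
  have : Continuous fun t : ℂ => MvPolynomial.eval (fun i => c i ^ k * t ^ a i) f :=
    (MvPolynomial.continuous_eval f).comp (by fun_prop)
  exact this

theorem eval_monomialCurve {m : ℕ} (c : Fin m → ℂ) (a : Fin m → ℕ) (k : ℕ) (t : ℂ)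
    (γ : Fin m →₀ ℕ) : ComplexPoints.eval (MvPolynomial.monomial γ 1) (monomialCurve c a k t) =
      (∏ i, c i ^ γ i) ^ k * t ^ weightedDegree a γ := by
  change MvPolynomial.aeval _ _ = _
  rw [MvPolynomial.aeval_monomial, map_one, one_mul, Finsupp.prod_fintype _ _ (by simp),
    weightedDegree, ← Finset.prod_pow_eq_pow_sum, ← Finset.prod_pow, ← Finset.prod_mul_distrib]
  refine Finset.prod_congr rfl fun i _ => ?_
  rw [mul_pow, ← pow_mul, ← pow_mul, ← pow_mul, mul_comm k]

/-- The common point of the curves is what makes the multipliers `q j x₀` independent of `k`. -/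
theorem monomialCurve_zero {m : ℕ} {c : Fin m → ℂ} {a : Fin m → ℕ} (hc : ∀ i, a i = 0 → c i = 1)
    (k : ℕ) : monomialCurve c a k 0 = monomialCurve c a 0 0 := by
  unfold monomialCurve
  congr 1
  ext i
  by_cases h : a i = 0
  · simp [h, hc i h]
  · simp [h]

theorem Polynomial.eval_eq_sum_fin (p : Polynomial ℂ) (x : ℂ) :
    p.eval x = ∑ k : Fin (p.natDegree + 1), p.coeff k * x ^ (k : ℕ) := by
  rw [Polynomial.eval_eq_sum_range, Finset.sum_range]

theorem monomial_notMem_continuousClosure {m : ℕ} {G : Finset (Fin m →₀ ℕ)} {γ : Fin m →₀ ℕ}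
    {a : Fin m → ℕ} (ha : ∀ δ ∈ G, weightedDegree a γ ≤ weightedDegree a δ)
    {c : Fin m → ℂ} {p : Polynomial ℂ} (hc : ∀ i, a i = 0 → c i = 1)
    (hp : p.eval (∏ i, c i ^ γ i) ≠ 0) (hpG : ∀ δ ∈ G, p.eval (∏ i, c i ^ δ i) = 0) :
    MvPolynomial.monomial γ (1 : ℂ) ∉ continuousClosure
      (Ideal.span ((fun γ => MvPolynomial.monomial γ (1 : ℂ)) '' (G : Set (Fin m →₀ ℕ)))) := by
  intro hmem
  let δ : Fin G.card → (Fin m →₀ ℕ) := fun j => (G.equivFin.symm j : Fin m →₀ ℕ)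
  have hδ : ∀ j, δ j ∈ G := fun j => (G.equivFin.symm j).2
  have hrange : (fun γ => MvPolynomial.monomial γ (1 : ℂ)) '' (G : Set (Fin m →₀ ℕ)) =
      Set.range fun j => MvPolynomial.monomial (δ j) (1 : ℂ) := by
    ext f
    constructor
    · rintro ⟨γ, hγ, rfl⟩
      exact ⟨G.equivFin ⟨γ, hγ⟩, by simp [δ]⟩
    · rintro ⟨j, rfl⟩
      exact ⟨δ j, hδ j, rfl⟩
  rw [hrange, mem_continuousClosure_span_iff] at hmem
  obtain ⟨q, hq, hf⟩ := hmem
  let x₀ := monomialCurve c a 0 0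
  -- Divide by `t ^ weightedDegree a γ` for `t ≠ 0` and let `t → 0`. The power of `0` is `1` exactly
  -- for generators of the same weight as `γ`.
  have hlim : ∀ k : ℕ, (∏ i, c i ^ γ i) ^ k = ∑ j, q j x₀ *
      ((∏ i, c i ^ δ j i) ^ k * 0 ^ (weightedDegree a (δ j) - weightedDegree a γ)) := by
    intro k
    have hcont : Continuous fun t : ℂ => ∑ j, q j (monomialCurve c a k t) *
        ((∏ i, c i ^ δ j i) ^ k * t ^ (weightedDegree a (δ j) - weightedDegree a γ)) :=
      continuous_finsetSum _ fun j _ => ((hq j).comp (continuous_monomialCurve c a k)).mul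
        (by fun_prop)
    have heq : (fun _ : ℂ => (∏ i, c i ^ γ i) ^ k) = fun t : ℂ =>
        ∑ j, q j (monomialCurve c a k t) *
          ((∏ i, c i ^ δ j i) ^ k * t ^ (weightedDegree a (δ j) - weightedDegree a γ)) := by
      refine Continuous.ext_on (dense_compl_singleton (0 : ℂ)) continuous_const hcont fun t ht => ?_
      have ht0 : t ^ weightedDegree a γ ≠ 0 := pow_ne_zero _ ht
      have h := hf (monomialCurve c a k t)
      simp only [eval_monomialCurve] at h
      refine mul_right_cancel₀ ht0 (h.trans ?_)
      rw [Finset.sum_mul]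
      refine Finset.sum_congr rfl fun j _ => ?_
      rw [← Nat.sub_add_cancel (ha _ (hδ j)), pow_add, Nat.add_sub_cancel]
      ring
    have := congrFun heq 0
    simp only [monomialCurve_zero hc k] at this
    exact this
  refine hp ?_
  rw [Polynomial.eval_eq_sum_fin, Finset.sum_congr rfl fun k _ => by rw [hlim, Finset.mul_sum],
    Finset.sum_comm]
  refine Finset.sum_eq_zero fun j _ => ?_
  have : ∑ k : Fin (p.natDegree + 1), p.coeff k * (q j x₀ * ((∏ i, c i ^ δ j i) ^ (k : ℕ) *
      0 ^ (weightedDegree a (δ j) - weightedDegree a γ))) =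
      (q j x₀ * 0 ^ (weightedDegree a (δ j) - weightedDegree a γ)) *
        p.eval (∏ i, c i ^ δ j i) := by
    rw [Polynomial.eval_eq_sum_fin, Finset.mul_sum]
    exact Finset.sum_congr rfl fun k _ => by ring
  rw [this, hpG _ (hδ j), mul_zero]

/-- The homomorphism to the coordinate axes whose restriction to the `k`-th axis is
`zᵢ ↦ cᵢᵏ X ^ aᵢ`. -/
noncomputable def monomialAxes {m : ℕ} (c : Fin m → ℂ) (a : Fin m → ℕ) (n : ℕ) :
    MvPolynomial (Fin m) ℂ →ₐ[ℂ] coordinateAxes ℂ (Fin n) :=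
  MvPolynomial.aeval fun i => if h : a i = 0 then 1 else
    coordinateAxes.ofFamily (fun k => Polynomial.C (c i ^ (k : ℕ)) * Polynomial.X ^ a i) fun k => by
      rw [Polynomial.coeff_C_mul, Polynomial.coeff_X_pow, if_neg (Ne.symm h), mul_zero]

theorem proj_monomialAxes {m : ℕ} {c : Fin m → ℂ} {a : Fin m → ℕ} (hc : ∀ i, a i = 0 → c i = 1)
    {n : ℕ} (k : Fin n) (γ : Fin m →₀ ℕ) :
    coordinateAxes.proj k (monomialAxes c a n (MvPolynomial.monomial γ 1)) =
      Polynomial.C ((∏ i, c i ^ γ i) ^ (k : ℕ)) * Polynomial.X ^ weightedDegree a γ := by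
  rw [monomialAxes, MvPolynomial.aeval_monomial, map_one, one_mul,
    Finsupp.prod_fintype _ _ (by simp), map_prod, weightedDegree, ← Finset.prod_pow_eq_pow_sum,
    ← Finset.prod_pow, map_prod, ← Finset.prod_mul_distrib]
  refine Finset.prod_congr rfl fun i _ => ?_
  rw [map_pow]
  by_cases h : a i = 0
  · simp [h, hc i h]
  · rw [dif_neg h, coordinateAxes.proj_ofFamily, mul_pow, ← Polynomial.C_pow, ← pow_mul, ← pow_mul,
      ← pow_mul, mul_comm (k : ℕ)]

theorem monomial_notMem_axesClosure {m : ℕ} {G : Finset (Fin m →₀ ℕ)} {γ : Fin m →₀ ℕ}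
    {a : Fin m → ℕ} (ha : ∀ δ ∈ G, weightedDegree a γ ≤ weightedDegree a δ)
    {c : Fin m → ℂ} {p : Polynomial ℂ} (hc : ∀ i, a i = 0 → c i = 1)
    (hp : p.eval (∏ i, c i ^ γ i) ≠ 0) (hpG : ∀ δ ∈ G, p.eval (∏ i, c i ^ δ i) = 0) :
    MvPolynomial.monomial γ (1 : ℂ) ∉ axesClosure ℂ
      (Ideal.span ((fun γ => MvPolynomial.monomial γ (1 : ℂ)) '' (G : Set (Fin m →₀ ℕ)))) := by
  intro hmem
  set n := p.natDegree + 1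
  set φ := monomialAxes c a n
  have h1 := hmem _ coordinateAxes.isRingOfAxes φ.toRingHom
  rw [Ideal.map_span, ← Set.image_comp] at h1
  -- A functional that kills the extended ideal but takes the value `p.eval (c^γ)` on the image of
  -- `z^γ`; there is one axis for each coefficient of `p`.
  let L : coordinateAxes ℂ (Fin n) → ℂ := fun h =>
    ∑ k : Fin n, p.coeff k * (coordinateAxes.proj k h).coeff (weightedDegree a γ)
  have hL : ∀ h ∈ Ideal.span ((φ.toRingHom ∘ fun γ => MvPolynomial.monomial γ (1 : ℂ)) ''
      (G : Set (Fin m →₀ ℕ))), ∀ r, L (r * h) = 0 := by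
    intro h hh
    induction hh using Submodule.span_induction with
    | zero => intro r; simp [L]
    | add x y _ _ hx hy =>
      intro r
      have : L (r * (x + y)) = L (r * x) + L (r * y) := by
        simp only [L, mul_add, map_add, Polynomial.coeff_add, Finset.sum_add_distrib]
      rw [this, hx, hy, add_zero]
    | smul s x _ hx =>
      intro r
      rw [smul_eq_mul, ← mul_assoc]
      exact hx _
    | mem x hx =>
      obtain ⟨δ, hδ, rfl⟩ := hx
      intro r
      -- Only the constant term of `r` can contribute, as `δ` has weight at least that of `γ`; it is
      -- the same on all axes, so it factors out of the sum over `k`.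
      have hcoeff : ∀ k : Fin n, (coordinateAxes.proj k
          (r * φ (MvPolynomial.monomial δ 1))).coeff (weightedDegree a γ) =
          (if weightedDegree a δ ≤ weightedDegree a γ then coordinateAxes.value 0 r else 0) *
            (∏ i, c i ^ δ i) ^ (k : ℕ) := by
        intro k
        rw [map_mul, proj_monomialAxes hc, ← mul_assoc, Polynomial.coeff_mul_X_pow']
        split_ifs with hle
        · rw [Nat.sub_eq_zero_of_le (ha δ hδ), Polynomial.mul_coeff_zero, Polynomial.coeff_C_zero,
            coordinateAxes.value_eq 0 k]
        · rw [zero_mul]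
      change ∑ k : Fin n, p.coeff k * (coordinateAxes.proj k
          (r * φ (MvPolynomial.monomial δ 1))).coeff (weightedDegree a γ) = 0
      have hsum := Polynomial.eval_eq_sum_fin p (∏ i, c i ^ δ i)
      rw [hpG δ hδ] at hsum
      rw [Finset.sum_congr rfl fun k _ => by rw [hcoeff, mul_left_comm], ← Finset.mul_sum, ← hsum,
        mul_zero]
  have h2 := hL _ h1 1
  rw [one_mul] at h2
  refine hp ?_
  rw [Polynomial.eval_eq_sum_fin, ← h2]
  refine Finset.sum_congr rfl fun k _ => ?_
  change _ = _ * (coordinateAxes.proj k (φ (MvPolynomial.monomial γ 1))).coeff _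
  rw [proj_monomialAxes hc, Polynomial.coeff_C_mul_X_pow, if_pos rfl]

/-! ### The two closures compared -/

theorem theorem5p1 (m : ℕ) (I : Ideal (MvPolynomial (Fin m) ℂ))
    (hprimary : I.IsPrimary) (hmonomial : IsMonomialIdeal I) :
    continuousClosure I = axesClosure ℂ I ∧
      axesClosure ℂ I =
        Ideal.span {f | ∃ γ : Fin m →₀ ℕ,
          (γ ∈ exponentSet I ∨ realExponent γ ∈ interiorConvexHull (exponentSet I)) ∧
            f = MvPolynomial.monomial γ (1 : ℂ)} := by
  obtain ⟨G, hG, hspan, hdom⟩ := hmonomial.exists_finset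
  obtain ⟨c₀, hc₀⟩ := exists_injective_monomial_values m
  have hweight : ∀ γ : Fin m →₀ ℕ, γ ∉ exponentSet I →
      realExponent γ ∉ interiorConvexHull (exponentSet I) →
      ∃ (a : Fin m → ℕ) (c : Fin m → ℂ) (p : Polynomial ℂ),
        (∀ δ ∈ G, weightedDegree a γ ≤ weightedDegree a δ) ∧ (∀ i, a i = 0 → c i = 1) ∧
        p.eval (∏ i, c i ^ γ i) ≠ 0 ∧ ∀ δ ∈ G, p.eval (∏ i, c i ^ δ i) = 0 := by
    intro γ hγ hint
    obtain ⟨a, d, hd, hγd, hda⟩ := (hasShrinkingCertificate_or_exists_weight G γ).resolve_left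
      fun h => hint (h.mem_interiorConvexHull (isUpperSet_exponentSet I) hG)
    obtain ⟨c, p, hc, hp, hpG⟩ := exists_separating_polynomial hprimary hγ hd (fun δ hδ => by
      obtain ⟨δ', hδ', hle⟩ := hdom δ hδ
      exact (hda δ' hδ').trans (weightedDegree_mono a hle)) hG
    exact ⟨a, c, p, fun δ hδ => hγd.trans (hda δ hδ), hc, hp, hpG⟩
  have hpow : ∀ γ : Fin m →₀ ℕ, realExponent γ ∈ interiorConvexHull (exponentSet I) →
      ∃ N : ℕ, MvPolynomial.monomial γ (1 : ℂ) ^ N ∈ I ^ (N + 1) := by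
    intro γ hint
    refine HasShrinkingCertificate.monomial_pow_mem hG
      ((hasShrinkingCertificate_or_exists_weight G γ).resolve_right ?_)
    rintro ⟨a, d, hd, hγd, hda⟩
    refine hγd.not_gt (lt_weightedDegree_of_mem_interiorConvexHull hint hd fun δ hδ => ?_)
    obtain ⟨δ', hδ', hle⟩ := hdom δ hδ
    exact (hda δ' hδ').trans (weightedDegree_mono a hle)
  -- These four properties determine an ideal uniquely, and both closures have them.
  have key : ∀ C : Ideal (MvPolynomial (Fin m) ℂ), I ≤ C →
      (∀ f N, f ^ N ∈ I ^ (N + 1) → f ∈ C) → (∀ f ∈ C, rescale c₀ f ∈ C) →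
      (∀ γ, γ ∉ exponentSet I → realExponent γ ∉ interiorConvexHull (exponentSet I) →
        MvPolynomial.monomial γ (1 : ℂ) ∉ C) →
      C = Ideal.span {f | ∃ γ : Fin m →₀ ℕ,
          (γ ∈ exponentSet I ∨ realExponent γ ∈ interiorConvexHull (exponentSet I)) ∧
            f = MvPolynomial.monomial γ (1 : ℂ)} := by
    intro C hIC hC hstable hnot
    refine le_antisymm (fun f hf => ?_) (Ideal.span_le.2 ?_)
    · rw [← MvPolynomial.support_sum_monomial_coeff f]
      refine sum_mem fun γ hγ => ?_
      rw [← mul_one (f.coeff γ), ← MvPolynomial.C_mul_monomial]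
      refine Ideal.mul_mem_left _ _ (Ideal.subset_span ⟨γ, ?_, rfl⟩)
      by_contra! h
      exact hnot γ h.1 h.2 (monomial_mem_of_rescale_stable hc₀ hstable hf hγ)
    · rintro _ ⟨γ, hγ | hγ, rfl⟩
      · exact hIC hγ
      · obtain ⟨N, hN⟩ := hpow γ hγ
        exact hC _ N hN
  have hcont := key (continuousClosure I) (le_continuousClosure I)
    (fun f N => mem_continuousClosure_of_pow_mem (IsNoetherian.noetherian I))
    (fun f => map_mem_continuousClosure (rescale c₀) fun g => hmonomial.rescale_mem c₀)
    (fun γ hγ hint => by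
      obtain ⟨a, c, p, ha, hc, hp, hpG⟩ := hweight γ hγ hint
      rw [hspan]
      exact monomial_notMem_continuousClosure ha hc hp hpG)
  have hax := key (axesClosure ℂ I) (le_axesClosure ℂ I)
    (fun f N hN T _ _ hT φ => hT.mem_of_pow_mem (N := N) (by
      rw [← map_pow, ← Ideal.map_pow]
      exact Ideal.mem_map_of_mem φ hN))
    (fun f => map_mem_axesClosure ℂ (rescale c₀).toRingHom fun g => hmonomial.rescale_mem c₀)
    (fun γ hγ hint => by
      obtain ⟨a, c, p, ha, hc, hp, hpG⟩ := hweight γ hγ hint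
      rw [hspan]
      exact monomial_notMem_axesClosure ha hc hp hpG)
  exact ⟨hcont.trans hax.symm, hax⟩
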